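/- **Setting.** Let $D\subset\mathbb R^d$ be a domain (open and connected) and let $$Au(x)=\tfrac12\mathrm{Tr}(\mathbf Q(x)\nabla^2u(x))+b(x)\cdot\nabla u(x)+\int_{\mathbb R^d}\Big(u(x+y)-u(x)-\frac{y\cdot\nabla u(x)}{1+|y|^2}\Big)N(x,dy),$$ where $\mathbf Q$ and $b$ are bounded and Borel measurable on $D$, $\mathbf Q(x)$ is non-negative definite for $x\in D$, and $N$ is a kernel of Borel measures on $\mathbb R^d\setminus\{0\}$ with $\sup_{x\in\mathbb R^d}\int\min\{1,|y|^2\}\,N(x,dy)<\infty$. Let $(P_x)_{x\in\mathbb R^d}$ be a strong Markovian solution of the martingale problem for $A$ on the space of càdlàg paths $[0,\infty)\to\mathbb R^d$, with canonical process $(X_t)$. That is: $x\mapsto P_x[C]$ is measurable for every measurable set of paths $C$; for every Borel probability measure $\mu$ (in particular $\mu=\delta_x$), under $P_\mu=\int P_x\,\mu(dx)$ the variable $X_0$ has law $\mu$ and $f(X_t)-f(X_0)-\int_0^tAf(X_r)\,dr$ is a well-defined martingale with respect to the natural filtration for every $f\in C^2_b(\mathbb R^d)$; and $(X_t)$ is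 strongly Markovian with respect to the natural filtration. Let $\tau_D=\inf\{t>0:X_t\notin D\}$ and assume $P_x[\tau_D<\infty]=1$ for all $x\in D$. Put $$P^D_tf(x)=\mathbb E_x[f(X_t);\,t<\tau_D],\qquad R^D_\alpha f(x)=\int_0^\infty e^{-\alpha t}P^D_tf(x)\,dt\in[0,\infty],\qquad x\in D,\ \alpha\ge0,\ f\ge0.$$ Let $m$ be a $\sigma$-finite Borel measure on $D$. Assume: - (irreducibility, IR$_m$) $R^D_1f(x)>0$ for all $x\in D$, for every bounded Borel $f:D\to[0,\infty)$ with $\int_Df\,dm>0$; - (Eig) $\varphi_D:D\to[0,\infty)$ is Borel, $\lambda_D\ge0$, $e^{-\lambda_Dt}\varphi_D=P^D_t\varphi_D$ on $D$ for all $t\ge0$, and $\int_D\varphi_D\,dm>0$ (so $m$ is non-trivial); - $\varphi_D$ is bounded. Then $\varphi_D>0$ on $D$, and the $\varphi_D$-process is the conservative Markov process on $D$ with transition semigroup $P^{D,\varphi_D}_tf=e^{\lambda_Dt}\varphi_D^{-1}P^D_t(f\varphi_D)$ and resolvent $R^{D,\varphi_D}_\alpha f=\int_0^\infty e^{-\alpha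 t}P^{D,\varphi_D}_tf\,dt$, $\alpha>0$. A transition semigroup $(P_t)_{t\ge0}$ on $D$ is *uniformly ergodic* if there are an invariant Borel probability measure $\Pi$ on $D$ and constants $C>0$, $\rho\in(0,1)$ with $\sup_{x\in D}\|P_t(x,\cdot)-\Pi\|_{TV}\le C\rho^t$ for all $t\ge0$, where $\|\nu\|_{TV}=\sup\{|\int f\,d\nu|:\ f \text{ Borel},\ |f|\le1\}$. Uniform ergodicity of a discrete-time Markov chain is defined in the same way, with $t$ replaced by $n=0,1,2,\dots$. A resolvent family $(R_\alpha)_{\alpha>0}$ is *uniformly ergodic* if for every $\alpha>0$ the Markov chain with transition probability $\alpha R_\alpha(x,\cdot)$ is uniformly ergodic. For $\alpha\ge0$ and a non-trivial Borel measure $\nu$ on $D$, condition $M'(\alpha,\nu)$ says that $$R^D_\alpha f(x)\ge\varphi_D(x)\int_Df\,d\nu\qquad\text{for all }x\in D\text{ and all bounded Borel }f:D\to[0,\infty).$$ **Theorem.** Under these assumptions, the following are equivalent: 1. for every $\alpha\ge0$ there is a non-trivial Borel measure $\nu^\alpha_D$ on $D$ such that $M'(\alpha,\nu^\alpha_D)$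 holds; 2. the resolvent $(R^{D,\varphi_D}_\alpha)_{\alpha>0}$ of the $\varphi_D$-process is uniformly ergodic. Moreover, if the semigroup $(P^{D,\varphi_D}_t)_{t\ge0}$ is uniformly ergodic, then for every $\alpha\ge0$ there is a Borel measure $\nu^\alpha_D$ on $D$ with $m\ll\nu^\alpha_D$ such that $M'(\alpha,\nu^\alpha_D)$ holds. -/

import Mathlib

open MeasureTheory ProbabilityTheory Filter Set
open scoped NNReal ENNReal Topology

noncomputable section

namespace LevyHopf

/-- The Euclidean space `ℝ^d`. -/
abbrev E (d : ℕ) : Type := EuclideanSpace ℝ (Fin d)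

/-! ### Lévy type integro-differential operators -/

/-- The coefficients of a Lévy type operator: diffusion matrix, drift and jump kernel. -/
structure Coeff (d : ℕ) where
  Q : E d → Matrix (Fin d) (Fin d) ℝ
  b : E d → E d
  N : Kernel (E d) (E d)

/-- `A u(x) = ½ Tr(Q(x) ∇²u(x)) + b(x) · ∇u(x)
  + ∫ (u(x+y) - u(x) - y · ∇u(x) / (1 + |y|²)) N(x,dy)`. -/
def Coeff.op {d : ℕ} (A : Coeff d) (u : E d → ℝ) (x : E d) : ℝ :=
  (1 / 2) * (∑ i, ∑ j, A.Q x i j *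
      iteratedFDeriv ℝ 2 u x ![EuclideanSpace.single j 1, EuclideanSpace.single i 1])
    + fderiv ℝ u x (A.b x)
    + ∫ y, (u (x + y) - u x - fderiv ℝ u x y / (1 + ‖y‖ ^ 2)) ∂(A.N x)

/-- On `D` the local coefficients are bounded and Borel measurable, and `Q` is non-negative
definite. -/
structure Coeff.LocalHyp {d : ℕ} (A : Coeff d) (D : Set (E d)) : Prop where
  measurable_Q : ∀ i j, Measurable fun x : D => A.Q x i j
  measurable_b : Measurable fun x : D => A.b x
  bounded : ∃ M : ℝ, ∀ x ∈ D, (∀ i j, |A.Q x i j| ≤ M) ∧ ‖A.b x‖ ≤ M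
  nonneg : ∀ x ∈ D, ∀ ξ : Fin d → ℝ, 0 ≤ ∑ i, ∑ j, A.Q x i j * ξ i * ξ j

/-- `N(x,·)` lives on `ℝ^d \ {0}` and `sup_x ∫ min(1,|y|²) N(x,dy) < ∞`
(the `σ`-finiteness of `N(x,·)` on `ℝ^d \ {0}` is a consequence). -/
structure Coeff.JumpHyp {d : ℕ} (A : Coeff d) : Prop where
  no_atom : ∀ x, A.N x {0} = 0
  bounded : ∃ M : ℝ≥0, ∀ x, ∫⁻ y, min 1 (‖y‖ₑ ^ 2) ∂(A.N x) ≤ M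

/-! ### Path space -/

/-- Right continuous with left limits in `ℝ^d`. -/
def IsCadlag {d : ℕ} (ω : ℝ≥0 → E d) : Prop :=
  ∀ t, ContinuousWithinAt ω (Ici t) t ∧ ∃ l, Tendsto ω (𝓝[<] t) (𝓝 l)

/-- The space of càdlàg paths `[0,∞) → ℝ^d`, with the `σ`-algebra generated by the coordinates
(this is the Borel `σ`-algebra of the Skorokhod topology). -/
abbrev Path (d : ℕ) : Type := {ω : ℝ≥0 → E d // IsCadlag ω}

/-- The canonical process. -/
def X {d : ℕ} (t : ℝ≥0) (ω : Path d) : E d := ω.1 t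

theorem measurable_X {d : ℕ} (t : ℝ≥0) : Measurable (X (d := d) t) :=
  (measurable_pi_apply t).comp measurable_subtype_coe

/-- The natural filtration of the canonical process. -/
def natFilt (d : ℕ) : Filtration ℝ≥0 (inferInstance : MeasurableSpace (Path d)) :=
  Filtration.natural X fun t => (measurable_X t).stronglyMeasurable

theorem IsCadlag.shift {d : ℕ} {ω : ℝ≥0 → E d} (h : IsCadlag ω) (s : ℝ≥0) :
    IsCadlag fun r => ω (s + r) := by
  intro t
  constructor
  · refine ContinuousWithinAt.comp (t := Ici (s + t)) (h (s + t)).1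
      (by fun_prop) fun r hr => ?_
    simpa using hr
  · obtain ⟨l, hl⟩ := (h (s + t)).2
    refine ⟨l, hl.comp ?_⟩
    refine tendsto_nhdsWithin_iff.2 ⟨?_, ?_⟩
    · have : Continuous fun r : ℝ≥0 => s + r := by fun_prop
      exact (this.tendsto t).mono_left nhdsWithin_le_nhds
    · filter_upwards [self_mem_nhdsWithin] with r hr
      simpa using hr

/-- The shift operator `(θ_s ω)(r) = ω(s + r)`. -/
def shift {d : ℕ} (s : ℝ≥0) (ω : Path d) : Path d := ⟨fun r => ω.1 (s + r), ω.2.shift s⟩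

/-! ### The martingale problem -/

/-- `C_b²(ℝ^d)`: `C²` functions that are bounded together with their first two derivatives. -/
def IsCb2 {d : ℕ} (f : E d → ℝ) : Prop :=
  ContDiff ℝ 2 f ∧
    ∃ M : ℝ, ∀ x, |f x| ≤ M ∧ ‖fderiv ℝ f x‖ ≤ M ∧ ‖iteratedFDeriv ℝ 2 f x‖ ≤ M

/-- `M_t[f] = f(X_t) - f(X_0) - ∫_0^t A f(X_r) dr`. -/
def martProc {d : ℕ} (A : Coeff d) (f : E d → ℝ) (t : ℝ≥0) (ω : Path d) : ℝ :=
  f (X t ω) - f (X 0 ω) - ∫ r in (0 : ℝ)..t, A.op f (X r.toNNReal ω)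

/-- `Pμ` solves the martingale problem for `A` with initial distribution `μ`. The field
`integrable` says that the time integral in `M_t[f]` makes sense almost surely; it is automatic
when the coefficients are bounded and Borel on all of `ℝ^d`. -/
structure IsMartSol {d : ℕ} (A : Coeff d) (μ : Measure (E d)) (Pμ : Measure (Path d)) : Prop where
  prob : IsProbabilityMeasure Pμ
  init : Pμ.map (X 0) = μ
  integrable : ∀ f, IsCb2 f → ∀ t : ℝ≥0, ∀ᵐ ω ∂Pμ,
    IntervalIntegrable (fun r : ℝ => A.op f (X r.toNNReal ω)) volume 0 t
  martingale : ∀ f, IsCb2 f → Martingale (martProc A f) (natFilt d) Pμ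

/-- Strong Markov property of the canonical process with respect to its natural filtration:
`P_x[Λ, τ < ∞, θ_τ ∈ C] = E_x[P_{X_τ}[C]; Λ, τ < ∞]` for every stopping time `τ`, every
`Λ ∈ ℱ_τ` and every measurable `C`. -/
def IsStrongMarkov {d : ℕ} (P : Kernel (E d) (Path d)) : Prop :=
  ∀ (τ : Path d → WithTop ℝ≥0) (hτ : IsStoppingTime (natFilt d) τ) (Λ C : Set (Path d)),
    MeasurableSet[hτ.measurableSpace] Λ → MeasurableSet C → ∀ x : E d,
      P x {ω | ω ∈ Λ ∧ τ ω ≠ ⊤ ∧ shift (τ ω).untopA ω ∈ C} =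
        ∫⁻ ω in {ω | ω ∈ Λ ∧ τ ω ≠ ⊤}, P (X (τ ω).untopA ω) C ∂(P x)

/-- A strong Markovian solution of the martingale problem for `A`. The measurability of
`x ↦ P_x[C]` is part of `P` being a kernel; `μ.bind P` is `∫ P_x(·) μ(dx)`. -/
structure IsStrongMarkovSol {d : ℕ} (A : Coeff d) (P : Kernel (E d) (Path d)) : Prop where
  sol : ∀ x, IsMartSol A (Measure.dirac x) (P x)
  strongMarkov : IsStrongMarkov P
  sol_init : ∀ μ : Measure (E d), IsProbabilityMeasure μ → IsMartSol A μ (μ.bind P)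

/-! ### Exit time, killed semigroup, resolvent -/

/-- `τ_D = inf {t > 0 : X_t ∉ D}`. -/
def exitTime {d : ℕ} (D : Set (E d)) (ω : Path d) : ℝ≥0∞ :=
  ⨅ (t : ℝ≥0) (_ : 0 < t ∧ X t ω ∉ D), (t : ℝ≥0∞)

/-- The exit time from `D` is a.s. finite from every starting point of `D`. -/
def ExitFinite {d : ℕ} (P : Kernel (E d) (Path d)) (D : Set (E d)) : Prop :=
  ∀ x ∈ D, ∀ᵐ ω ∂(P x), exitTime D ω < ⊤

/-- `P^D_t f(x) = E_x[f(X_t); t < τ_D]` for `f : D → [0,∞]`. The extension of `f` by `0` outside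
`D` is immaterial. -/
def killed {d : ℕ} (P : Kernel (E d) (Path d)) (D : Set (E d)) (t : ℝ≥0)
    (f : D → ℝ≥0∞) (x : D) : ℝ≥0∞ :=
  ∫⁻ ω in {ω | (t : ℝ≥0∞) < exitTime D ω},
    Function.extend (Subtype.val : D → E d) f 0 (X t ω) ∂(P x)

/-- The resolvent `∫_0^∞ e^{-αt} T_t f(x) dt` of a semigroup acting on `[0,∞]`-valued functions. -/
def resolvent {S : Type*} (T : ℝ≥0 → (S → ℝ≥0∞) → S → ℝ≥0∞) (α : ℝ)
    (f : S → ℝ≥0∞) (x : S) : ℝ≥0∞ :=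
  ∫⁻ t in Ioi (0 : ℝ), ENNReal.ofReal (Real.exp (-(α * t))) * T t.toNNReal f x

/-- `R^D_α`. -/
def killedResolvent {d : ℕ} (P : Kernel (E d) (Path d)) (D : Set (E d)) (α : ℝ) :
    (D → ℝ≥0∞) → D → ℝ≥0∞ :=
  resolvent (killed P D) α

/-- Non-negative bounded Borel functions. -/
def IsBbPos {S : Type*} [MeasurableSpace S] (f : S → ℝ≥0) : Prop :=
  Measurable f ∧ ∃ M : ℝ≥0, ∀ x, f x ≤ M

/-- `m`-irreducibility: `R^D_1 f > 0` everywhere on `D` for every non-negative bounded Borel `f`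
with `∫ f dm > 0`. -/
def Irred {d : ℕ} (P : Kernel (E d) (Path d)) (D : Set (E d)) (m : Measure D) : Prop :=
  ∀ f : D → ℝ≥0, IsBbPos f → 0 < ∫⁻ x, f x ∂m →
    ∀ x, 0 < killedResolvent P D 1 (fun y => f y) x

/-- `φ` is a non-negative eigenfunction with eigenvalue `lam`:
`e^{-lam t} φ = P^D_t φ`, `∫ φ dm > 0`. -/
structure IsEigen {d : ℕ} (P : Kernel (E d) (Path d)) (D : Set (E d)) (m : Measure D)
    (φ : D → ℝ≥0) (lam : ℝ) : Prop where
  measurable : Measurable φ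
  lam_nonneg : 0 ≤ lam
  eigen : ∀ (t : ℝ≥0) (x : D),
    ENNReal.ofReal (Real.exp (-(lam * t))) * φ x = killed P D t (fun y => φ y) x
  pos : 0 < ∫⁻ x, φ x ∂m

/-- The transition semigroup of the `φ`-process,
`P^{D,φ}_t f(x) = e^{lam t} P^D_t(f φ)(x) / φ(x)`. -/
def doob {d : ℕ} (P : Kernel (E d) (Path d)) (D : Set (E d)) (φ : D → ℝ≥0) (lam : ℝ)
    (t : ℝ≥0) (f : D → ℝ≥0∞) (x : D) : ℝ≥0∞ :=
  ENNReal.ofReal (Real.exp (lam * t)) * killed P D t (fun y => f y * φ y) x / φ x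

/-- The minorization condition `M'(α, ν)`: `ν` is non-trivial and
`R^D_α f ≥ φ ∫ f dν` on `D` for every non-negative bounded Borel `f`. -/
def Minorization {d : ℕ} (P : Kernel (E d) (Path d)) (D : Set (E d)) (φ : D → ℝ≥0)
    (α : ℝ) (ν : Measure D) : Prop :=
  ν ≠ 0 ∧ ∀ f : D → ℝ≥0, IsBbPos f → ∀ x : D,
    (φ x : ℝ≥0∞) * ∫⁻ y, f y ∂ν ≤ killedResolvent P D α (fun y => f y) x

/-! ### Uniform ergodicity

A family of transition probabilities is given by the operators `T f(x) = ∫ f(y) T(x,dy)` on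
`[0,∞]`-valued functions. -/

/-- `T f(x)` for a real bounded function `f`, namely `T f⁺(x) - T f⁻(x)`. -/
def actReal {S : Type*} (T : (S → ℝ≥0∞) → S → ℝ≥0∞) (f : S → ℝ) (x : S) : ℝ :=
  (T (fun y => ENNReal.ofReal (f y)) x).toReal - (T (fun y => ENNReal.ofReal (-f y)) x).toReal

/-- `sup_x ‖T(x,·) - Π‖_TV`, where `‖ν‖_TV = sup {|∫ f dν| : |f| ≤ 1}`. -/
def supTV {S : Type*} [MeasurableSpace S] (T : (S → ℝ≥0∞) → S → ℝ≥0∞)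
    (Pinv : Measure S) : ℝ≥0∞ :=
  ⨆ (x : S) (f : {f : S → ℝ // Measurable f ∧ ∀ y, |f y| ≤ 1}),
    ENNReal.ofReal |actReal T f.1 x - ∫ y, f.1 y ∂Pinv|

/-- `Pinv` is invariant for the transition probability `T`. -/
def IsInvariant {S : Type*} [MeasurableSpace S] (T : (S → ℝ≥0∞) → S → ℝ≥0∞)
    (Pinv : Measure S) : Prop :=
  ∀ B : Set S, MeasurableSet B → ∫⁻ x, T (B.indicator 1) x ∂Pinv = Pinv B

/-- Uniform ergodicity of a transition semigroup `(T_t)_{t ≥ 0}`. -/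
def UnifErgSemigroup {S : Type*} [MeasurableSpace S]
    (T : ℝ≥0 → (S → ℝ≥0∞) → S → ℝ≥0∞) : Prop :=
  ∃ Pinv : Measure S, IsProbabilityMeasure Pinv ∧ (∀ t, IsInvariant (T t) Pinv) ∧
    ∃ C ρ : ℝ, 0 < C ∧ 0 < ρ ∧ ρ < 1 ∧
      ∀ t : ℝ≥0, supTV (T t) Pinv ≤ ENNReal.ofReal (C * ρ ^ (t : ℝ))

/-- Uniform ergodicity of the Markov chain with transition probability `K`. -/
def UnifErgChain {S : Type*} [MeasurableSpace S] (K : (S → ℝ≥0∞) → S → ℝ≥0∞) : Prop :=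
  ∃ Pinv : Measure S, IsProbabilityMeasure Pinv ∧ IsInvariant K Pinv ∧
    ∃ C ρ : ℝ, 0 < C ∧ 0 < ρ ∧ ρ < 1 ∧
      ∀ n : ℕ, supTV (K^[n]) Pinv ≤ ENNReal.ofReal (C * ρ ^ n)

/-- The resolvent family of the semigroup `T` is uniformly ergodic: for every `α > 0`, the chain
with transition probability `α R_α` is. -/
def UnifErgResolvent {S : Type*} [MeasurableSpace S]
    (T : ℝ≥0 → (S → ℝ≥0∞) → S → ℝ≥0∞) : Prop :=
  ∀ α : ℝ, 0 < α → UnifErgChain fun f x => ENNReal.ofReal α * resolvent T α f x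

end LevyHopf

end

/-!
Let `(Q_t)` be the semigroup of the `φ`-process and `U_α` its resolvent. Irreducibility applied to
the eigenfunction gives `φ > 0`, and `φ` bounded with `τ_D < ∞` gives `lam > 0`. Since
`U_{α+lam} f = φ⁻¹ R^D_α (f φ)` (`resolvent_doob`), the condition `M'(α, ν)` says that `U_{α+lam}`
dominates a fixed measure, uniformly in the starting point.

* Minorization implies ergodicity by Doeblin's theorem (`Represents.unifErgChain`): if every
  `κ x` dominates `η`, then a step of the chain contracts oscillations by `1 - η(S)`, and the
  invariant law is the sum of the images of `η` under the iterates of the residual `κ - η`.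
* Conversely, if the transition probabilities `κ x` are all within `1/8` of a probability measure
  `Π`, then `κ z` has a density with respect to `Π` that is at least `1/2` on a set of mass at
  least `3/4`, for `Π`-almost every `z`; composing two steps gives a measure `η` dominated by all
  `κ²(x, ·)` (`Represents.exists_minorization`). No theory of small sets is required. For a
  `κ` that is an iterate of `β U_β`, the resolvent inequality
  `U_β U_β' ≤ (β - β')⁻¹ U_β'` turns this into `∫ U_β' f dη ≤ c U_β' f` for `β' < β`; for `κ = Q_t`
  one uses `Q_t U_β ≤ e^{βt} U_β` instead. Such a bound is the minorization condition with a
  measure `ν` of density `1 / φ` with respect to a multiple of `η U_β`, and `m ≪ ν` follows from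
  irreducibility, because `U_β f > 0` everywhere as soon as `∫ f dm > 0`.

The measurability of the exit time needs care. With the raw `σ`-algebra on the path space, the event
`{t < τ_D}` is the complement of a projection, and is only null measurable for each finite measure.
This is proved in `nullMeasurableSet_exists_eq_zero`, by the argument behind Choquet's
capacitability theorem: the random set of times at which the path is outside `D` is a countable
intersection of countable unions of random compact sets. Consequently all transition probabilities
are universally measurable in the starting point (`UnivMeas`), and the whole argument is carried out
for universally measurable functions; `Represents` records that an operator is integration against
such a family. The Markov property at deterministic times then gives the semigroup property
(`killed_add`), using that `{t < τ_D}` belongs to `ℱ_t` up to a null set.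
-/

noncomputable section

namespace LevyHopf

section

/-! ### Universally measurable maps -/

/-- A map is universally measurable if it is almost everywhere measurable for every finite
measure on its source. -/
def UnivMeas {α β : Type*} [MeasurableSpace α] [MeasurableSpace β] (f : α → β) : Prop :=
  ∀ μ : Measure α, IsFiniteMeasure μ → AEMeasurable f μ

section UnivMeas

variable {α β γ : Type*} [MeasurableSpace α] [MeasurableSpace β] [MeasurableSpace γ]

theorem _root_.Measurable.univMeas {f : α → β} (hf : Measurable f) : UnivMeas f :=
  fun _ _ => hf.aemeasurable

theorem UnivMeas.aemeasurable {f : α → β} (hf : UnivMeas f) (μ : Measure α) [SFinite μ] :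
    AEMeasurable f μ := by
  obtain ⟨ν, hν, hμν, -⟩ := exists_isFiniteMeasure_absolutelyContinuous μ
  exact (hf ν hν).mono_ac hμν

theorem UnivMeas.comp_measurable {f : β → γ} (hf : UnivMeas f) {g : α → β} (hg : Measurable g) :
    UnivMeas fun x => f (g x) := fun μ _ =>
  (hf (μ.map g) inferInstance).comp_measurable hg

theorem UnivMeas.mul {f g : α → ℝ≥0∞} (hf : UnivMeas f) (hg : UnivMeas g) :
    UnivMeas fun x => f x * g x := fun μ hμ => (hf μ hμ).mul (hg μ hμ)

theorem isFiniteMeasure_bind {μ : Measure α} [IsFiniteMeasure μ] {κ : α → Measure β}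
    (hκ : AEMeasurable κ μ) (h1 : ∀ a, κ a univ ≤ 1) : IsFiniteMeasure (μ.bind κ) := by
  refine ⟨?_⟩
  rw [Measure.bind_apply MeasurableSet.univ hκ]
  calc ∫⁻ a, κ a univ ∂μ ≤ ∫⁻ _, 1 ∂μ := lintegral_mono h1
    _ < ⊤ := by simp

theorem UnivMeas.lintegral {κ : α → Measure β} (hκ : UnivMeas κ) (h1 : ∀ a, κ a univ ≤ 1)
    {f : β → ℝ≥0∞} (hf : UnivMeas f) : UnivMeas fun a => ∫⁻ b, f b ∂κ a := fun μ hμ => by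
  have := isFiniteMeasure_bind (hκ μ hμ) h1
  have h := hf (μ.bind κ) this
  exact (Measure.aemeasurable_lintegral (m := μ.map κ) h).comp_aemeasurable (hκ μ hμ)

theorem UnivMeas.lintegral_bind {κ : α → Measure β} (hκ : UnivMeas κ) (h1 : ∀ a, κ a univ ≤ 1)
    {f : β → ℝ≥0∞} (hf : UnivMeas f) (μ : Measure α) [hμ : IsFiniteMeasure μ] :
    ∫⁻ b, f b ∂(μ.bind κ) = ∫⁻ a, ∫⁻ b, f b ∂κ a ∂μ :=
  Measure.lintegral_bind (hκ μ hμ) (hf _ (isFiniteMeasure_bind (hκ μ hμ) h1))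

theorem UnivMeas.bind {κ : α → Measure β} (hκ : UnivMeas κ) (h1 : ∀ a, κ a univ ≤ 1)
    {κ' : β → Measure γ} (hκ' : UnivMeas κ') : UnivMeas fun a => (κ a).bind κ' := fun μ hμ => by
  have h := hκ' (μ.bind κ) (isFiniteMeasure_bind (hκ μ hμ) h1)
  refine ((Measure.measurable_bind' h.measurable_mk).comp_aemeasurable (hκ μ hμ)).congr ?_
  filter_upwards [Measure.ae_ae_of_ae_bind (hκ μ hμ) h.ae_eq_mk] with a ha
  exact (Measure.bind_congr_right ha).symm

/-- A mixture over a parameter of jointly universally measurable families is universally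
measurable. -/
theorem UnivMeas.bind_left {ρ : Measure α} [IsProbabilityMeasure ρ] {q : α × β → Measure γ}
    (hq : UnivMeas q) : UnivMeas fun b => ρ.bind fun a => q (a, b) := fun μ hμ => by
  have h := hq ((ρ.prod μ)) inferInstance
  have h2 : Measurable fun b => ρ.bind fun a => h.mk q (a, b) := by
    refine Measure.measurable_of_measurable_coe _ fun B hB => ?_
    have : ∀ b, (ρ.bind fun a => h.mk q (a, b)) B = ∫⁻ a, h.mk q (a, b) B ∂ρ := fun b =>
      Measure.bind_apply hB (h.measurable_mk.comp (by fun_prop)).aemeasurable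
    simp_rw [this]
    exact ((Measure.measurable_coe hB).comp h.measurable_mk).lintegral_prod_left'
  refine h2.aemeasurable.congr ?_
  have h3 : ∀ᵐ z ∂(μ.prod ρ), q (z.2, z.1) = h.mk q (z.2, z.1) :=
    (Measure.measurePreserving_swap (μ := μ) (ν := ρ)).quasiMeasurePreserving.ae h.ae_eq_mk
  filter_upwards [Measure.ae_ae_of_ae_prod h3] with b hb
  exact (Measure.bind_congr_right hb).symm

end UnivMeas

/-! ### Transition operators -/

variable {S : Type*} [MeasurableSpace S]

/-- The operator `K` on `[0,∞]`-valued functions is integration against the universally measurable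
family of probability measures `κ`, as far as universally measurable functions are concerned. -/
structure Represents (K : (S → ℝ≥0∞) → S → ℝ≥0∞) (κ : S → Measure S) : Prop where
  prob : ∀ x, IsProbabilityMeasure (κ x)
  univMeas : UnivMeas κ
  eq : ∀ f, UnivMeas f → ∀ x, K f x = ∫⁻ y, f y ∂κ x

theorem abs_toReal_sub_le {x y a b e : ℝ≥0∞} (hx : x ≠ ⊤) (hy : y ≠ ⊤) (he : e ≠ ⊤)
    (hab : b ≤ a + e) (hax : a ≤ x) (hxb : x ≤ b) (hay : a ≤ y) (hyb : y ≤ b) :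
    |x.toReal - y.toReal| ≤ e.toReal := by
  have h1 : x ≤ y + e := hxb.trans (hab.trans (by gcongr))
  have h2 : y ≤ x + e := hyb.trans (hab.trans (by gcongr))
  have h1' := ENNReal.toReal_mono (by simp [hy, he]) h1
  have h2' := ENNReal.toReal_mono (by simp [hx, he]) h2
  rw [ENNReal.toReal_add hy he] at h1'
  rw [ENNReal.toReal_add hx he] at h2'
  rw [abs_sub_le_iff]
  constructor <;> linarith

namespace Represents

variable {K L : (S → ℝ≥0∞) → S → ℝ≥0∞} {κ l : S → Measure S}

theorem le_one (h : Represents K κ) (x : S) : κ x univ ≤ 1 := by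
  have := h.prob x
  simp

theorem univMeas_op (h : Represents K κ) {f : S → ℝ≥0∞} (hf : UnivMeas f) : UnivMeas (K f) := by
  have : K f = fun x => ∫⁻ y, f y ∂κ x := funext fun x => h.eq f hf x
  rw [this]
  exact h.univMeas.lintegral h.le_one hf

theorem comp (h : Represents K κ) (h' : Represents L l) :
    Represents (K ∘ L) fun x => (κ x).bind l where
  prob x := by
    have := h.prob x
    have := h'.prob
    refine ⟨?_⟩
    rw [Measure.bind_apply MeasurableSet.univ (h'.univMeas _ inferInstance)]
    simp
  univMeas := h.univMeas.bind h.le_one h'.univMeas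
  eq f hf x := by
    have := h.prob x
    rw [Function.comp_apply, h.eq _ (h'.univMeas_op hf),
      h'.univMeas.lintegral_bind h'.le_one hf]
    exact lintegral_congr fun y => h'.eq f hf y

theorem id : Represents (id : (S → ℝ≥0∞) → S → ℝ≥0∞) Measure.dirac where
  prob x := inferInstance
  univMeas := Measure.measurable_dirac.univMeas
  eq f hf x := by
    have h := hf (Measure.dirac x) inferInstance
    rw [lintegral_congr_ae h.ae_eq_mk, lintegral_dirac' _ h.measurable_mk]
    by_contra hne
    have h1 : (Measure.dirac x) {y | ¬ f y = h.mk f y} = 0 := h.ae_eq_mk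
    have h2 := Measure.le_dirac_apply (s := {y | ¬ f y = h.mk f y}) (a := x)
    rw [h1, indicator_of_mem (by exact hne)] at h2
    simp at h2

theorem iterate (h : Represents K κ) (n : ℕ) : ∃ κn, Represents (K^[n]) κn := by
  induction n with
  | zero => exact ⟨_, Represents.id⟩
  | succ n ih =>
    obtain ⟨κn, hn⟩ := ih
    rw [Function.iterate_succ']
    exact ⟨_, h.comp hn⟩

theorem mono (h : Represents K κ) {f g : S → ℝ≥0∞} (hf : UnivMeas f) (hg : UnivMeas g)
    (hfg : ∀ x, f x ≤ g x) (x : S) : K f x ≤ K g x := by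
  rw [h.eq f hf, h.eq g hg]
  exact lintegral_mono hfg

/-! ### Doeblin's condition -/

/-- Under Doeblin's condition `η ≤ κ x`, one step of the chain shrinks the oscillation of a
function by the factor `1 - η(S)`. -/
theorem exists_bounds_iterate (h : Represents K κ) {η : Measure S} [IsFiniteMeasure η]
    (hη : ∀ x, η ≤ κ x) {f : S → ℝ≥0∞} (hf : UnivMeas f) (hf1 : ∀ x, f x ≤ 1) (n : ℕ) :
    ∃ a b : ℝ≥0∞, b ≤ a + (1 - η univ) ^ n ∧ ∀ x, a ≤ K^[n] f x ∧ K^[n] f x ≤ b := by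
  induction n with
  | zero => exact ⟨0, 1, by simp, fun x => ⟨zero_le, hf1 x⟩⟩
  | succ n ih =>
    obtain ⟨a, b, hab, hx⟩ := ih
    obtain ⟨κn, hn⟩ := h.iterate n
    set g := K^[n] f with hg
    have hgm : UnivMeas g := hn.univMeas_op hf
    have key : ∀ x, ∃ r : Measure S, r univ = 1 - η univ ∧
        K^[n + 1] f x = ∫⁻ y, g y ∂η + ∫⁻ y, g y ∂r := by
      intro x
      have := h.prob x
      refine ⟨κ x - η, ?_, ?_⟩
      · rw [Measure.sub_apply MeasurableSet.univ (hη x), measure_univ]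
      · rw [Function.iterate_succ_apply', ← hg, h.eq g hgm]
        conv_lhs => rw [← Measure.sub_add_cancel_of_le (hη x)]
        rw [lintegral_add_measure, add_comm]
    refine ⟨∫⁻ y, g y ∂η + a * (1 - η univ), ∫⁻ y, g y ∂η + b * (1 - η univ), ?_, ?_⟩
    · calc ∫⁻ y, g y ∂η + b * (1 - η univ)
          ≤ ∫⁻ y, g y ∂η + (a + (1 - η univ) ^ n) * (1 - η univ) := by gcongr
        _ = _ := by ring
    · intro x
      obtain ⟨r, hr, hK⟩ := key x
      rw [hK]
      constructor
      · gcongr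
        calc a * (1 - η univ) = ∫⁻ _, a ∂r := by simp [hr]
          _ ≤ _ := lintegral_mono fun y => (hx y).1
      · gcongr
        calc ∫⁻ y, g y ∂r ≤ ∫⁻ _, b ∂r := lintegral_mono fun y => (hx y).2
          _ = b * (1 - η univ) := by simp [hr]

/-- Under Doeblin's condition there is an invariant probability measure. With the residual
`κ x - η`, it is the sum over `n` of the images of `η` under `n` residual steps. -/
theorem exists_bind_eq_self [Nonempty S] (h : Represents K κ) {η : Measure S}
    (hη0 : η ≠ 0) (hη : ∀ x, η ≤ κ x) :
    ∃ Pinv : Measure S, IsProbabilityMeasure Pinv ∧ Pinv.bind κ = Pinv := by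
  obtain ⟨x₀⟩ := ‹Nonempty S›
  have hp := h.prob
  have hfin : IsFiniteMeasure η := ⟨((hη x₀) univ).trans_lt (measure_lt_top _ _)⟩
  have hc1 : η univ ≤ 1 := by simpa using hη x₀ univ
  have hc0 : η univ ≠ 0 := by simpa using hη0
  obtain ⟨u, hu0, hus⟩ : ∃ u : ℕ → Measure S, u 0 = η ∧
      ∀ n, u (n + 1) = (u n).bind κ - u n univ • η :=
    ⟨fun n => Nat.rec η (fun _ ν => ν.bind κ - ν univ • η) n, rfl, fun _ => rfl⟩
  have hufin : ∀ n, IsFiniteMeasure (u n) := by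
    intro n
    induction n with
    | zero => rwa [hu0]
    | succ n ih =>
      rw [hus]
      have := isFiniteMeasure_bind (h.univMeas _ ih) h.le_one
      exact ⟨(Measure.sub_le (ν := u n univ • η) univ).trans_lt (measure_lt_top ((u n).bind κ) _)⟩
  have hle : ∀ n, u n univ • η ≤ (u n).bind κ := by
    intro n
    refine Measure.le_iff.2 fun B hB => ?_
    rw [Measure.bind_apply hB (h.univMeas _ (hufin n))]
    calc (u n univ • η) B = ∫⁻ _, η B ∂u n := by simp [mul_comm]
      _ ≤ _ := lintegral_mono fun x => hη x B
  have hrec : ∀ n, u (n + 1) + u n univ • η = (u n).bind κ := by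
    intro n
    have := hufin n
    have : IsFiniteMeasure (u n univ • η) := Measure.smul_finite _ (measure_ne_top (u n) _)
    rw [hus, Measure.sub_add_cancel_of_le (hle n)]
  have hmass : ∀ n, u n univ = η univ * (1 - η univ) ^ n := by
    intro n
    induction n with
    | zero => simp [hu0]
    | succ n ih =>
      have := hufin n
      have : IsFiniteMeasure (u n univ • η) := Measure.smul_finite _ (measure_ne_top (u n) _)
      rw [hus, Measure.sub_apply MeasurableSet.univ (hle n),
        Measure.bind_apply MeasurableSet.univ (h.univMeas _ (hufin n))]
      simp only [measure_univ, lintegral_one, Measure.smul_apply, smul_eq_mul]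
      rw [pow_succ, ← mul_assoc, ← ih, ENNReal.mul_sub (fun _ _ => measure_ne_top (u n) _), mul_one]
  -- the masses form a geometric series
  have htot : ∑' n, u n univ = 1 := by
    simp_rw [hmass]
    rw [ENNReal.tsum_mul_left, ENNReal.tsum_geometric, ENNReal.sub_sub_cancel (by simp) hc1,
      ENNReal.mul_inv_cancel hc0 (measure_ne_top _ _)]
  have hsum : IsProbabilityMeasure (Measure.sum u) :=
    ⟨by rw [Measure.sum_apply _ MeasurableSet.univ, htot]⟩
  refine ⟨Measure.sum u, hsum, ?_⟩
  · ext B hB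
    rw [Measure.bind_apply hB (h.univMeas _ inferInstance), lintegral_sum_measure,
      Measure.sum_apply _ hB]
    have : ∀ n, ∫⁻ x, κ x B ∂u n = u (n + 1) B + u n univ * η B := by
      intro n
      rw [← Measure.bind_apply hB (h.univMeas _ (hufin n)), ← hrec]
      simp
    simp_rw [this]
    rw [ENNReal.tsum_add, ENNReal.tsum_mul_right, htot, one_mul,
      tsum_eq_zero_add' (f := fun n => u n B) ENNReal.summable, hu0, add_comm]

theorem isInvariant (h : Represents K κ) {Pinv : Measure S} [hp : IsProbabilityMeasure Pinv]
    (hinv : Pinv.bind κ = Pinv) : IsInvariant K Pinv := by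
  intro B hB
  have h1 : UnivMeas (B.indicator (1 : S → ℝ≥0∞)) := (measurable_one.indicator hB).univMeas
  conv_rhs => rw [← hinv]
  rw [Measure.bind_apply hB (h.univMeas _ inferInstance)]
  refine lintegral_congr fun x => ?_
  rw [h.eq _ h1, lintegral_indicator_one hB]

theorem lintegral_iterate (h : Represents K κ) {Pinv : Measure S} [hp : IsProbabilityMeasure Pinv]
    (hinv : Pinv.bind κ = Pinv) {f : S → ℝ≥0∞} (hf : UnivMeas f) (n : ℕ) :
    ∫⁻ x, K^[n] f x ∂Pinv = ∫⁻ x, f x ∂Pinv := by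
  induction n generalizing f with
  | zero => rfl
  | succ n ih =>
    simp_rw [Function.iterate_succ_apply]
    rw [ih (h.univMeas_op hf)]
    conv_rhs => rw [← hinv]
    rw [h.univMeas.lintegral_bind h.le_one hf]
    exact lintegral_congr fun x => h.eq f hf x

/-- Doeblin's theorem. -/
theorem unifErgChain [Nonempty S] (h : Represents K κ) {η : Measure S}
    (hη0 : η ≠ 0) (hη : ∀ x, η ≤ κ x) : UnifErgChain K := by
  obtain ⟨Pinv, hP, hinv⟩ := h.exists_bind_eq_self hη0 hη
  obtain ⟨x₀⟩ := ‹Nonempty S›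
  have hp := h.prob
  have hfin : IsFiniteMeasure η := ⟨((hη x₀) univ).trans_lt (measure_lt_top _ _)⟩
  have hc0 : η univ ≠ 0 := by simpa using hη0
  have hlt : (1 - η univ).toReal < 1 := by
    have : 1 - η univ < 1 := ENNReal.sub_lt_self (by simp) (by simp) hc0
    simpa using (ENNReal.toReal_lt_toReal (by simp) (by simp)).2 this
  refine ⟨Pinv, hP, h.isInvariant hinv, 2, max (1 - η univ).toReal (1 / 2), by norm_num,
    lt_max_of_lt_right (by norm_num), max_lt hlt (by norm_num), fun n => ?_⟩
  refine iSup₂_le fun x f => ENNReal.ofReal_le_ofReal ?_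
  obtain ⟨f, hf, hf1⟩ := f
  -- the estimate for functions with values in `[0,1]`
  have key : ∀ g : S → ℝ, Measurable g → (∀ y, g y ≤ 1) →
      |(K^[n] (fun y => ENNReal.ofReal (g y)) x).toReal - (∫⁻ y, ENNReal.ofReal (g y) ∂Pinv).toReal|
        ≤ (1 - η univ).toReal ^ n := by
    intro g hg hg1
    have hgm : UnivMeas fun y => ENNReal.ofReal (g y) := hg.ennreal_ofReal.univMeas
    have hgb : ∀ y, ENNReal.ofReal (g y) ≤ 1 := fun y => ENNReal.ofReal_le_one.2 (hg1 y)
    obtain ⟨a, b, hab, hx⟩ := h.exists_bounds_iterate hη hgm hgb n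
    obtain ⟨κn, hn⟩ := h.iterate n
    have hpn := hn.prob
    have hfx : K^[n] (fun y => ENNReal.ofReal (g y)) x ≤ 1 := by
      rw [hn.eq _ hgm]
      calc _ ≤ ∫⁻ _, 1 ∂κn x := lintegral_mono hgb
        _ = 1 := by simp
    have hfP : ∫⁻ y, ENNReal.ofReal (g y) ∂Pinv ≤ 1 := by
      calc _ ≤ ∫⁻ _, 1 ∂Pinv := lintegral_mono hgb
        _ = 1 := by simp
    rw [← ENNReal.toReal_pow]
    refine abs_toReal_sub_le (ne_top_of_le_ne_top (by simp) hfx)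
      (ne_top_of_le_ne_top (by simp) hfP) (by simp) hab (hx x).1 (hx x).2 ?_ ?_
    · rw [← h.lintegral_iterate hinv hgm n]
      calc a = ∫⁻ _, a ∂Pinv := by simp
        _ ≤ _ := lintegral_mono fun y => (hx y).1
    · rw [← h.lintegral_iterate hinv hgm n]
      calc _ ≤ ∫⁻ _, b ∂Pinv := lintegral_mono fun y => (hx y).2
        _ = b := by simp
  have hint : Integrable f Pinv :=
    Integrable.of_bound hf.aestronglyMeasurable 1 (ae_of_all _ hf1)
  have k1 := key f hf fun y => (abs_le.1 (hf1 y)).2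
  have k2 := key (fun y => -f y) hf.neg fun y => by linarith [(abs_le.1 (hf1 y)).1]
  have hpow : (1 - η univ).toReal ^ n ≤ max (1 - η univ).toReal (1 / 2) ^ n := by
    gcongr
    exact le_max_left _ _
  simp only [actReal]
  rw [integral_eq_lintegral_pos_part_sub_lintegral_neg_part hint]
  rw [abs_le] at k1 k2 ⊢
  constructor <;> linarith [k1.1, k1.2, k2.1, k2.2]

/-! ### Minorization from ergodicity -/

theorem measure_le_of_supTV_le (h : Represents K κ) {Pinv : Measure S}
    [hp : IsProbabilityMeasure Pinv] {ε : ℝ} (hε : 0 ≤ ε)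
    (hTV : supTV K Pinv ≤ ENNReal.ofReal ε) (x : S) {B : Set S} (hB : MeasurableSet B) :
    Pinv B ≤ κ x B + ENNReal.ofReal ε := by
  have := h.prob x
  let f : {f : S → ℝ // Measurable f ∧ ∀ y, |f y| ≤ 1} :=
    ⟨B.indicator 1, measurable_one.indicator hB, fun y => by
      by_cases hy : y ∈ B <;> simp [hy]⟩
  have h1 : ENNReal.ofReal |actReal K f.1 x - ∫ y, f.1 y ∂Pinv| ≤ ENNReal.ofReal ε :=
    (le_iSup₂ (f := fun (x : S) (f : {f : S → ℝ // Measurable f ∧ ∀ y, |f y| ≤ 1}) =>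
      ENNReal.ofReal |actReal K f.1 x - ∫ y, f.1 y ∂Pinv|) x f).trans hTV
  rw [ENNReal.ofReal_le_ofReal_iff hε] at h1
  have e1 : (fun y => ENNReal.ofReal (f.1 y)) = B.indicator (1 : S → ℝ≥0∞) := by
    ext y
    by_cases hy : y ∈ B <;> simp [f, hy]
  have e2 : (fun y => ENNReal.ofReal (-f.1 y)) = fun _ => (0 : ℝ≥0∞) := by
    ext y
    by_cases hy : y ∈ B <;> simp [f, hy]
  have e3 : ∫ y, f.1 y ∂Pinv = (Pinv B).toReal := by
    simp only [f]
    rw [integral_indicator_one hB, measureReal_def]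
  have e4 : actReal K f.1 x = (κ x B).toReal := by
    rw [actReal, e1, e2, h.eq _ (measurable_one.indicator hB).univMeas,
      h.eq _ measurable_const.univMeas, lintegral_indicator_one hB]
    simp
  rw [e3, e4] at h1
  have h2 : (Pinv B).toReal ≤ (κ x B).toReal + ε := by linarith [(abs_le.1 h1).1]
  rw [← ENNReal.ofReal_toReal (measure_ne_top Pinv B), ← ENNReal.ofReal_toReal
    (measure_ne_top (κ x) B), ← ENNReal.ofReal_add ENNReal.toReal_nonneg hε]
  exact ENNReal.ofReal_le_ofReal h2

end Represents

end

section

variable {S : Type*} [MeasurableSpace S]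
namespace Represents
variable {K L : (S → ℝ≥0∞) → S → ℝ≥0∞} {κ l : S → Measure S}

/-- The density of `κ z` with respect to `Pinv` exceeds `1/2` on a large set, uniformly in `z`
outside a `Pinv`-null set `N`, and the relation `G` recording this is measurable. -/
theorem exists_density_relation [MeasurableSpace.CountablyGenerated S] (h : Represents K κ)
    {Pinv : Measure S} [hp : IsProbabilityMeasure Pinv]
    (hle : ∀ x B, MeasurableSet B → Pinv B ≤ κ x B + 8⁻¹) :
    ∃ (N : Set S) (G : Set (S × S)), MeasurableSet N ∧ Pinv N = 0 ∧ MeasurableSet G ∧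
      (∀ z ∉ N, ∀ B, MeasurableSet B → 2⁻¹ * Pinv (B ∩ {y | (z, y) ∈ G}) ≤ κ z B) ∧
      ∀ z ∉ N, 3 / 4 ≤ Pinv {y | (z, y) ∈ G} := by
  classical
  have hprob := h.prob
  have hae := h.univMeas Pinv inferInstance
  -- a Markov kernel that agrees with `κ` almost everywhere; `Kernel.rnDeriv` needs a kernel
  have hkm : Measurable fun z => if hae.mk κ z univ = 1 then hae.mk κ z else Pinv :=
    Measurable.ite ((Measure.measurable_coe MeasurableSet.univ).comp hae.measurable_mk
      (measurableSet_singleton 1)) hae.measurable_mk measurable_const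
  let k : Kernel S S := ⟨_, hkm⟩
  have hkdef : ∀ z, k z = if hae.mk κ z univ = 1 then hae.mk κ z else Pinv := fun z => rfl
  have hk1 : IsMarkovKernel k := ⟨fun z => by
    rw [hkdef]
    split_ifs with hz
    · exact ⟨hz⟩
    · exact hp⟩
  have hkae : ∀ᵐ z ∂Pinv, k z = κ z := by
    filter_upwards [hae.ae_eq_mk] with z hz
    rw [hkdef, ← hz, if_pos (measure_univ (μ := κ z))]
  obtain ⟨N, hN, hNm, hN0⟩ := exists_measurable_superset_of_null (ae_iff.1 hkae)
  have hkN : ∀ z ∉ N, k z = κ z := fun z hz => by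
    by_contra hne
    exact hz (hN hne)
  set p := Kernel.rnDeriv k (Kernel.const S Pinv) with hpdef
  have hpm : Measurable fun z : S × S => p z.1 z.2 := Kernel.measurable_rnDeriv _ _
  have hpm' : ∀ z, Measurable (p z) := fun z => Kernel.measurable_rnDeriv_right _ _ z
  refine ⟨N, {z | 2⁻¹ ≤ p z.1 z.2}, hNm, hN0, measurableSet_le measurable_const hpm,
    fun z hz B hB => ?_, fun z hz => ?_⟩
  · have hG : MeasurableSet {y | 2⁻¹ ≤ p z y} := measurableSet_le measurable_const (hpm' z)
    rw [← hkN z hz]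
    have h1 := Kernel.withDensity_rnDeriv_le k (Kernel.const S Pinv) z B
    rw [Kernel.withDensity_apply' _ hpm, Kernel.const_apply] at h1
    refine le_trans ?_ h1
    calc 2⁻¹ * Pinv (B ∩ {y | 2⁻¹ ≤ p z y})
        = ∫⁻ _ in B ∩ {y | 2⁻¹ ≤ p z y}, 2⁻¹ ∂Pinv := by simp
      _ ≤ ∫⁻ y in B ∩ {y | 2⁻¹ ≤ p z y}, p z y ∂Pinv :=
        setLIntegral_mono (hpm' z) fun y hy => hy.2
      _ ≤ ∫⁻ y in B, p z y ∂Pinv := lintegral_mono_set inter_subset_left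
  -- off the slice carrying the singular part, `κ z` has density `p z < 1/2` outside `G`
  · set s := Kernel.mutuallySingularSetSlice k (Kernel.const S Pinv) z with hs
    have hsm : MeasurableSet s := Kernel.measurableSet_mutuallySingularSetSlice _ _ _
    have hs0 : Pinv s = 0 := Kernel.measure_mutuallySingularSetSlice k (Kernel.const S Pinv) z
    have hG : MeasurableSet {y | 2⁻¹ ≤ p z y} := measurableSet_le measurable_const (hpm' z)
    set B := {y | 2⁻¹ ≤ p z y}ᶜ \ s with hB
    have hBm : MeasurableSet B := hG.compl.diff hsm
    have h1 : κ z B ≤ 2⁻¹ * Pinv B := by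
      rw [← hkN z hz, ← Kernel.withDensity_rnDeriv_of_subset_compl_mutuallySingularSetSlice
        (κ := k) (η := Kernel.const S Pinv) (a := z) (s := B) hBm (fun y hy => hy.2),
        Kernel.withDensity_apply' _ hpm, Kernel.const_apply]
      calc ∫⁻ y in B, p z y ∂Pinv ≤ ∫⁻ _ in B, 2⁻¹ ∂Pinv :=
            setLIntegral_mono measurable_const fun y hy =>
              (not_le.1 (show ¬ 2⁻¹ ≤ p z y from hy.1)).le
        _ = _ := by simp
    have h2 : Pinv {y | 2⁻¹ ≤ p z y}ᶜ = Pinv B := (measure_sdiff_null hs0).symm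
    have h3 := (hle z B hBm).trans (add_le_add_left h1 _)
    have h4 : Pinv {y | 2⁻¹ ≤ p z y} + Pinv B = 1 := by
      rw [← h2, measure_add_measure_compl hG, measure_univ]
    change 3 / 4 ≤ Pinv {y | 2⁻¹ ≤ p z y}
    have hf1 := measure_ne_top Pinv B
    have hf2 := measure_ne_top Pinv {y | 2⁻¹ ≤ p z y}
    generalize Pinv B = b at *
    generalize Pinv {y | 2⁻¹ ≤ p z y} = a at *
    lift a to ℝ≥0 using hf2
    lift b to ℝ≥0 using hf1
    have e : (3 / 4 : ℝ≥0∞) = ((3 / 4 : ℝ≥0) : ℝ≥0∞) := by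
      rw [ENNReal.coe_div (by norm_num)]
      simp
    have e8 : (8⁻¹ : ℝ≥0∞) = ((8⁻¹ : ℝ≥0) : ℝ≥0∞) := by
      rw [ENNReal.coe_inv (by norm_num)]
      simp
    have e2 : (2⁻¹ : ℝ≥0∞) = ((2⁻¹ : ℝ≥0) : ℝ≥0∞) := by
      rw [ENNReal.coe_inv (by norm_num)]
      simp
    rw [e]
    rw [e8, e2] at h3
    norm_cast at h3 h4 ⊢
    rw [← NNReal.coe_le_coe] at h3 ⊢
    rw [← NNReal.coe_inj] at h4
    push_cast at h3 h4 ⊢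
    linarith

/-- If every `κ x` is close to `Pinv` on sets, then two steps of the chain dominate a multiple of
the restriction of `Pinv` to the set `Y` of points `y` such that `(z, y)` is in the density
relation `G` for at least half of the points `z`. -/
theorem exists_minorization [MeasurableSpace.CountablyGenerated S] (h : Represents K κ)
    {Pinv : Measure S} [hp : IsProbabilityMeasure Pinv]
    (hle : ∀ x B, MeasurableSet B → Pinv B ≤ κ x B + 8⁻¹) :
    ∃ η : Measure S, IsFiniteMeasure η ∧ η ≠ 0 ∧ ∀ x, η ≤ (κ x).bind κ := by
  obtain ⟨N, G, hN, hN0, hG, hGκ, hGP⟩ := h.exists_density_relation hle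
  have hprob := h.prob
  set Y := {y | 2⁻¹ ≤ Pinv {z | (z, y) ∈ G}} with hY
  have hYm : MeasurableSet Y :=
    measurableSet_le measurable_const (measurable_measure_prodMk_right hG)
  have hY0 : Pinv Y ≠ 0 := by
    intro h0
    have h1 : 3 / 4 ≤ (Pinv.prod Pinv) G := by
      rw [Measure.prod_apply hG]
      calc (3 / 4 : ℝ≥0∞) = ∫⁻ _, 3 / 4 ∂Pinv := by simp
        _ ≤ _ := by
          refine lintegral_mono_ae ?_
          filter_upwards [measure_eq_zero_iff_ae_notMem.1 hN0] with z hz using hGP z hz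
    have h2 : (Pinv.prod Pinv) G ≤ 2⁻¹ := by
      rw [Measure.prod_apply_symm hG]
      calc _ ≤ ∫⁻ _, 2⁻¹ ∂Pinv := by
            refine lintegral_mono_ae ?_
            filter_upwards [measure_eq_zero_iff_ae_notMem.1 h0] with y hy using (not_le.1 hy).le
        _ = 2⁻¹ := by simp
    have h3 := ENNReal.toReal_mono (by simp) (h1.trans h2)
    norm_num at h3
  refine ⟨(8⁻¹ : ℝ≥0∞) • Pinv.restrict Y, Measure.smul_finite _ (by simp), ?_, fun x => ?_⟩
  · intro h0
    have := congrArg (fun ν => ν univ) h0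
    simp [hY0] at this
  refine Measure.le_iff.2 fun B hB => ?_
  rw [Measure.bind_apply hB (h.univMeas _ inferInstance)]
  set H : Set (S × S) := G ∩ (Nᶜ ×ˢ B) with hH
  have hHm : MeasurableSet H := hG.inter (hN.compl.prod hB)
  have hH1 : ∫⁻ z, 2⁻¹ * Pinv (Prod.mk z ⁻¹' H) ∂κ x ≤ ∫⁻ z, κ z B ∂κ x := by
    refine lintegral_mono fun z => ?_
    by_cases hz : z ∈ N
    · have : Prod.mk z ⁻¹' H = ∅ := by
        ext y
        simp [hH, hz]
      simp [this]
    · refine le_trans ?_ (hGκ z hz B hB)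
      gcongr
      exact fun y hy => ⟨hy.2.2, hy.1⟩
  refine le_trans ?_ hH1
  rw [lintegral_const_mul _ (measurable_measure_prodMk_left hHm), ← Measure.prod_apply hHm,
    Measure.prod_apply_symm hHm, Measure.smul_apply, Measure.restrict_apply hB, smul_eq_mul]
  -- `κ x` gives mass at least `1/2 - 1/8` to the good points `z` of each `y ∈ Y`
  have hquart : ∀ y ∈ B ∩ Y, 4⁻¹ ≤ κ x ((fun z => (z, y)) ⁻¹' H) := by
    intro y hy
    have e : (fun z => (z, y)) ⁻¹' H = {z | (z, y) ∈ G} \ N := by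
      ext z
      simp [hH, hy.1]
    have hm : MeasurableSet ({z | (z, y) ∈ G} \ N) :=
      (measurable_prodMk_right hG).diff hN
    have h1 := hle x _ hm
    rw [measure_sdiff_null hN0] at h1
    rw [e]
    have h2 := hy.2.trans h1
    have hf := measure_ne_top (κ x) ({z | (z, y) ∈ G} \ N)
    generalize κ x ({z | (z, y) ∈ G} \ N) = a at *
    have h3 := ENNReal.toReal_mono (by simp [hf]) h2
    rw [ENNReal.toReal_add hf (by simp)] at h3
    rw [← ENNReal.toReal_le_toReal (by simp) hf]
    norm_num at h3 ⊢
    linarith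
  calc 8⁻¹ * Pinv (B ∩ Y) = 2⁻¹ * ∫⁻ _ in B ∩ Y, 4⁻¹ ∂Pinv := by
        rw [lintegral_const, Measure.restrict_apply_univ, ← mul_assoc,
          ← ENNReal.mul_inv (by simp) (by simp)]
        norm_num
    _ ≤ 2⁻¹ * ∫⁻ y in B ∩ Y, κ x ((fun z => (z, y)) ⁻¹' H) ∂Pinv := by
        gcongr 2⁻¹ * ?_
        exact setLIntegral_mono (measurable_measure_prodMk_right hHm) hquart
    _ ≤ _ := by
        gcongr
        exact Measure.restrict_le_self

theorem exists_le_op_op [MeasurableSpace.CountablyGenerated S] (h : Represents K κ)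
    {Pinv : Measure S} [hp : IsProbabilityMeasure Pinv]
    (hTV : supTV K Pinv ≤ ENNReal.ofReal (1 / 8)) :
    ∃ η : Measure S, IsFiniteMeasure η ∧ η ≠ 0 ∧
      ∀ f, UnivMeas f → ∀ x, ∫⁻ y, f y ∂η ≤ K (K f) x := by
  have e8 : ENNReal.ofReal (1 / 8) = 8⁻¹ := by
    rw [ENNReal.ofReal_div_of_pos (by norm_num)]
    simp
  obtain ⟨η, hη, hη0, hle⟩ := h.exists_minorization (Pinv := Pinv) fun x B hB => by
    have := h.measure_le_of_supTV_le (by norm_num) hTV x hB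
    rwa [e8] at this
  refine ⟨η, hη, hη0, fun f hf x => ?_⟩
  have := (h.comp h).eq f hf x
  rw [Function.comp_apply] at this
  rw [this]
  exact lintegral_mono' (hle x) le_rfl

end Represents

end

section

variable {S : Type*} [MeasurableSpace S]

/-! ### Markov semigroups and their resolvents -/

/-- A Markov semigroup given by the transition probabilities `q t x`, which are universally
measurable jointly in time and space. -/
structure UnivMarkovSemigroup (T : ℝ≥0 → (S → ℝ≥0∞) → S → ℝ≥0∞)
    (q : ℝ≥0 → S → Measure S) : Prop where
  represents : ∀ t, Represents (T t) (q t)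
  univMeas : UnivMeas fun z : ℝ≥0 × S => q z.1 z.2
  comp : ∀ s t f, UnivMeas f → ∀ x, T (s + t) f x = T s (T t f) x

theorem lintegral_exp_neg_mul_Ioi {a : ℝ} (ha : 0 < a) :
    ∫⁻ t in Ioi (0 : ℝ), ENNReal.ofReal (Real.exp (-(a * t))) = ENNReal.ofReal a⁻¹ := by
  have h1 : IntegrableOn (fun t : ℝ => Real.exp (-(a * t))) (Ioi 0) := by
    simpa using exp_neg_integrableOn_Ioi 0 ha
  rw [← ofReal_integral_eq_lintegral_ofReal h1 (ae_of_all _ fun t => (Real.exp_pos _).le)]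
  have h2 := integral_exp_mul_Ioi (a := -a) (by linarith) 0
  simp only [neg_mul, mul_zero, Real.exp_zero] at h2
  rw [h2, neg_div_neg_eq, one_div]

/-- The law on `(0, ∞)` of an exponential time of parameter `α`. -/
def expLaw (α : ℝ) : Measure ℝ :=
  (volume.restrict (Ioi 0)).withDensity fun t =>
    ENNReal.ofReal α * ENNReal.ofReal (Real.exp (-(α * t)))

theorem isProbabilityMeasure_expLaw {α : ℝ} (hα : 0 < α) : IsProbabilityMeasure (expLaw α) := by
  refine ⟨?_⟩
  rw [expLaw, withDensity_apply _ MeasurableSet.univ, setLIntegral_univ,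
    lintegral_const_mul _ (by fun_prop), lintegral_exp_neg_mul_Ioi hα,
    ← ENNReal.ofReal_mul hα.le, mul_inv_cancel₀ hα.ne', ENNReal.ofReal_one]

theorem exists_pow_le {C ρ : ℝ} (hρ : 0 < ρ) (hρ1 : ρ < 1) {e : ℝ} (he : 0 < e) :
    ∃ n : ℕ, C * ρ ^ n ≤ e := by
  have : Tendsto (fun n : ℕ => C * ρ ^ n) atTop (𝓝 (C * 0)) :=
    (tendsto_pow_atTop_nhds_zero_of_lt_one hρ.le hρ1).const_mul C
  rw [mul_zero] at this
  exact (this.eventually_le_const he).exists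

theorem resolvent_antitone {S : Type*} (T : ℝ≥0 → (S → ℝ≥0∞) → S → ℝ≥0∞) {α β : ℝ}
    (h : α ≤ β) (f : S → ℝ≥0∞) (x : S) : resolvent T β f x ≤ resolvent T α f x := by
  refine setLIntegral_mono' measurableSet_Ioi fun t ht => ?_
  have ht' : (0 : ℝ) ≤ t := (mem_Ioi.1 ht).le
  gcongr

namespace UnivMarkovSemigroup

variable {T : ℝ≥0 → (S → ℝ≥0∞) → S → ℝ≥0∞} {q : ℝ≥0 → S → Measure S}

theorem univMeas_op (h : UnivMarkovSemigroup T q) {f : S → ℝ≥0∞} (hf : UnivMeas f) :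
    UnivMeas fun z : ℝ × S => T z.1.toNNReal f z.2 := by
  have h1 : UnivMeas fun z : ℝ≥0 × S => T z.1 f z.2 := by
    have : (fun z : ℝ≥0 × S => T z.1 f z.2) = fun z => ∫⁻ y, f y ∂q z.1 z.2 :=
      funext fun z => (h.represents z.1).eq f hf z.2
    rw [this]
    exact h.univMeas.lintegral (fun z => (h.represents z.1).le_one z.2) hf
  exact h1.comp_measurable (g := fun z : ℝ × S => (z.1.toNNReal, z.2)) (by fun_prop)

theorem univMeas_weighted (h : UnivMarkovSemigroup T q) (α : ℝ) {f : S → ℝ≥0∞}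
    (hf : UnivMeas f) : UnivMeas fun z : ℝ × S =>
      ENNReal.ofReal (Real.exp (-(α * z.1))) * T z.1.toNNReal f z.2 := by
  refine UnivMeas.mul (Measurable.univMeas ?_) (h.univMeas_op hf)
  fun_prop

theorem aemeasurable_weighted (h : UnivMarkovSemigroup T q) (α : ℝ) {f : S → ℝ≥0∞}
    (hf : UnivMeas f) (x : S) (ν : Measure ℝ) [SFinite ν] : AEMeasurable (fun t : ℝ =>
      ENNReal.ofReal (Real.exp (-(α * t))) * T t.toNNReal f x) ν :=
  ((h.univMeas_weighted α hf).comp_measurable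
    (g := fun t : ℝ => (t, x)) (by fun_prop)).aemeasurable ν

theorem univMeas_resolvent (h : UnivMarkovSemigroup T q) (α : ℝ) {f : S → ℝ≥0∞}
    (hf : UnivMeas f) : UnivMeas (resolvent T α f) := fun μ _ => by
  have := ((h.univMeas_weighted α hf).comp_measurable
    (g := fun z : S × ℝ => (z.2, z.1)) (by fun_prop)).aemeasurable
      (μ.prod (volume.restrict (Ioi 0)))
  exact this.lintegral_prod_right'

/-- `α U_α` is the transition operator of the semigroup observed at an exponential time. -/
theorem represents_resolvent (h : UnivMarkovSemigroup T q) {α : ℝ} (hα : 0 < α) :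
    Represents (fun f x => ENNReal.ofReal α * resolvent T α f x)
      fun x => (expLaw α).bind fun t => q t.toNNReal x := by
  have := isProbabilityMeasure_expLaw hα
  have hq : ∀ x, UnivMeas fun t : ℝ => q t.toNNReal x := fun x =>
    h.univMeas.comp_measurable (g := fun t : ℝ => (t.toNNReal, x)) (by fun_prop)
  refine ⟨fun x => ⟨?_⟩, ?_, fun f hf x => ?_⟩
  · have := fun t => (h.represents t).prob x
    rw [Measure.bind_apply MeasurableSet.univ (hq x _ inferInstance)]
    simp
  · exact UnivMeas.bind_left (q := fun z : ℝ × S => q z.1.toNNReal z.2)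
      (h.univMeas.comp_measurable (g := fun z : ℝ × S => (z.1.toNNReal, z.2)) (by fun_prop))
  · rw [(hq x).lintegral_bind (fun t => (h.represents _).le_one x) hf, expLaw,
      lintegral_withDensity_eq_lintegral_mul₀ (by fun_prop), resolvent,
      ← lintegral_const_mul'' _ (h.aemeasurable_weighted α hf x _)]
    · refine lintegral_congr fun t => ?_
      rw [(h.represents _).eq f hf, Pi.mul_apply, mul_assoc]
    · have := ((hq x).lintegral (fun t => (h.represents _).le_one x) hf).aemeasurable
        (volume.restrict (Ioi 0))
      exact this

/-- `T_s U_β f ≤ e^{βs} U_β f`. -/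
theorem op_resolvent_le (h : UnivMarkovSemigroup T q) (β : ℝ) {f : S → ℝ≥0∞}
    (hf : UnivMeas f) (s : ℝ≥0) (x : S) :
    T s (resolvent T β f) x ≤ ENNReal.ofReal (Real.exp (β * s)) * resolvent T β f x := by
  have hp := (h.represents s).prob x
  set F : ℝ → ℝ≥0∞ := fun t => ENNReal.ofReal (Real.exp (-(β * t))) * T t.toNNReal f x with hF
  have hswap : T s (resolvent T β f) x = ∫⁻ t in Ioi (0 : ℝ),
      ENNReal.ofReal (Real.exp (β * s)) * F (s + t) := by
    rw [(h.represents s).eq _ (h.univMeas_resolvent β hf)]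
    unfold resolvent
    have hz := ((h.univMeas_weighted β hf).comp_measurable
      (g := fun z : S × ℝ => (z.2, z.1)) (by fun_prop)).aemeasurable
      ((q s x).prod (volume.restrict (Ioi 0)))
    rw [lintegral_lintegral_swap hz]
    refine setLIntegral_congr_fun measurableSet_Ioi fun t ht => ?_
    have ht' : (0 : ℝ) ≤ t := (mem_Ioi.1 ht).le
    have hst : (s + t : ℝ).toNNReal = s + t.toNNReal := by
      rw [Real.toNNReal_add (NNReal.coe_nonneg s) ht', Real.toNNReal_coe]
    have hTm : UnivMeas (T t.toNNReal f) := (h.represents _).univMeas_op hf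
    simp only [hF]
    rw [lintegral_const_mul'' _ (hTm _ inferInstance), ← (h.represents s).eq _ hTm,
      ← h.comp _ _ f hf,
      hst, ← mul_assoc, ← ENNReal.ofReal_mul (Real.exp_pos _).le, ← Real.exp_add]
    congr 3
    ring_nf
  rw [hswap, lintegral_const_mul' _ _ (by simp)]
  gcongr
  change _ ≤ ∫⁻ t in Ioi (0 : ℝ), F t
  rw [← lintegral_indicator measurableSet_Ioi, ← lintegral_indicator measurableSet_Ioi,
    ← lintegral_add_left_eq_self ((Ioi (0 : ℝ)).indicator F) (s : ℝ)]
  refine lintegral_mono fun t => ?_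
  by_cases ht : 0 < t
  · have : (0 : ℝ) < s + t := add_pos_of_nonneg_of_pos (NNReal.coe_nonneg s) ht
    simp [indicator, ht, this]
  · simp [indicator, ht]

/-- The resolvent inequality `U_β U_β' f ≤ (β - β')⁻¹ U_β' f`. -/
theorem resolvent_resolvent_le (h : UnivMarkovSemigroup T q) {β β' : ℝ} (hβ : β' < β)
    {f : S → ℝ≥0∞} (hf : UnivMeas f) (x : S) :
    resolvent T β (resolvent T β' f) x ≤ ENNReal.ofReal (β - β')⁻¹ * resolvent T β' f x := by
  rw [← lintegral_exp_neg_mul_Ioi (sub_pos.2 hβ), ← lintegral_mul_const _ (by fun_prop)]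
  refine setLIntegral_mono' measurableSet_Ioi fun t ht => ?_
  have ht' : (0 : ℝ) ≤ t := (mem_Ioi.1 ht).le
  calc _ ≤ ENNReal.ofReal (Real.exp (-(β * t))) *
        (ENNReal.ofReal (Real.exp (β' * t.toNNReal)) * resolvent T β' f x) := by
        gcongr
        exact h.op_resolvent_le β' hf _ x
    _ = _ := by
        rw [← mul_assoc, ← ENNReal.ofReal_mul (Real.exp_pos _).le, ← Real.exp_add,
          Real.coe_toNNReal _ ht']
        congr 3
        ring

theorem resolvent_eq_zero_iff (h : UnivMarkovSemigroup T q) (α : ℝ) {f : S → ℝ≥0∞}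
    (hf : UnivMeas f) (x : S) :
    resolvent T α f x = 0 ↔ ∀ᵐ t : ℝ ∂volume.restrict (Ioi 0), T t.toNNReal f x = 0 := by
  rw [resolvent, lintegral_eq_zero_iff' (h.aemeasurable_weighted α hf x _)]
  refine eventually_congr (ae_of_all _ fun t => ?_)
  simp [Real.exp_pos]

theorem iterate_resolvent_le (h : UnivMarkovSemigroup T q) {β β' : ℝ} (hβ0 : 0 < β)
    (hβ : β' < β) {f : S → ℝ≥0∞} (hf : UnivMeas f) (n : ℕ) (x : S) :
    (fun f x => ENNReal.ofReal β * resolvent T β f x)^[n] (resolvent T β' f) x ≤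
      (ENNReal.ofReal β * ENNReal.ofReal (β - β')⁻¹) ^ n * resolvent T β' f x := by
  have hK := h.represents_resolvent hβ0
  set K := fun (f : S → ℝ≥0∞) (x : S) => ENNReal.ofReal β * resolvent T β f x with hKdef
  set c := ENNReal.ofReal β * ENNReal.ofReal (β - β')⁻¹ with hc
  have hg : UnivMeas (resolvent T β' f) := h.univMeas_resolvent β' hf
  induction n generalizing x with
  | zero => simp
  | succ n ih =>
    obtain ⟨κn, hn⟩ := hK.iterate n
    have hcg : UnivMeas fun y => c ^ n * resolvent T β' f y :=
      measurable_const.univMeas.mul hg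
    rw [Function.iterate_succ_apply']
    refine (hK.mono (hn.univMeas_op hg) hcg ih x).trans ?_
    have := hK.prob x
    rw [hK.eq _ hcg, lintegral_const_mul'' _ (hg _ inferInstance), ← hK.eq _ hg, pow_succ,
      mul_assoc (c ^ n)]
    gcongr
    rw [hKdef, hc, mul_assoc]
    dsimp only
    gcongr
    exact h.resolvent_resolvent_le hβ hf x

/-- Uniform ergodicity of the chain `β U_β` bounds `U_β' f` from below by a multiple of
its mean under a fixed measure, for `β' < β`. -/
theorem exists_le_resolvent_of_unifErgChain [MeasurableSpace.CountablyGenerated S]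
    (h : UnivMarkovSemigroup T q) {β β' : ℝ} (hβ0 : 0 < β) (hβ : β' < β)
    (hE : UnifErgChain fun f x => ENNReal.ofReal β * resolvent T β f x) :
    ∃ (η : Measure S) (c : ℝ≥0∞), IsFiniteMeasure η ∧ η ≠ 0 ∧ c ≠ ⊤ ∧
      ∀ f, UnivMeas f → ∀ x, ∫⁻ y, resolvent T β' f y ∂η ≤ c * resolvent T β' f x := by
  obtain ⟨Pinv, hP, -, C, ρ, -, hρ0, hρ1, hTV⟩ := hE
  obtain ⟨n, hn⟩ := exists_pow_le (C := C) hρ0 hρ1 (e := 1 / 8) (by norm_num)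
  obtain ⟨κn, hκn⟩ := (h.represents_resolvent hβ0).iterate n
  obtain ⟨η, hη, hη0, hle⟩ := hκn.exists_le_op_op (Pinv := Pinv)
    ((hTV n).trans (ENNReal.ofReal_le_ofReal hn))
  refine ⟨η, (ENNReal.ofReal β * ENNReal.ofReal (β - β')⁻¹) ^ (n + n), hη, hη0,
    ENNReal.pow_ne_top (ENNReal.mul_ne_top (by simp) (by simp)), fun f hf x => ?_⟩
  refine (hle _ (h.univMeas_resolvent β' hf) x).trans ?_
  rw [← Function.iterate_add_apply]
  exact h.iterate_resolvent_le hβ0 hβ hf _ x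

/-- Uniform ergodicity of the semigroup bounds `U_β f` from below by a multiple of its mean under a
fixed measure. -/
theorem exists_le_resolvent_of_unifErgSemigroup [MeasurableSpace.CountablyGenerated S]
    (h : UnivMarkovSemigroup T q) (β : ℝ) (hE : UnifErgSemigroup T) :
    ∃ (η : Measure S) (c : ℝ≥0∞), IsFiniteMeasure η ∧ η ≠ 0 ∧ c ≠ ⊤ ∧
      ∀ f, UnivMeas f → ∀ x, ∫⁻ y, resolvent T β f y ∂η ≤ c * resolvent T β f x := by
  obtain ⟨Pinv, hP, -, C, ρ, -, hρ0, hρ1, hTV⟩ := hE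
  obtain ⟨n, hn⟩ := exists_pow_le (C := C) hρ0 hρ1 (e := 1 / 8) (by norm_num)
  obtain ⟨η, hη, hη0, hle⟩ := (h.represents n).exists_le_op_op (Pinv := Pinv)
    ((hTV n).trans (ENNReal.ofReal_le_ofReal (by simpa using hn)))
  refine ⟨η, ENNReal.ofReal (Real.exp (β * ((n : ℝ≥0) + (n : ℝ≥0) : ℝ≥0))), hη, hη0, by simp,
    fun f hf x => ?_⟩
  refine (hle _ (h.univMeas_resolvent β hf) x).trans ?_
  rw [← h.comp _ _ _ (h.univMeas_resolvent β hf)]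
  exact h.op_resolvent_le β hf _ x

end UnivMarkovSemigroup

end

section

/-! ### Projections of random sets that are countable intersections of `σ`-compact ones -/

section Capacity

variable {Ω Z : Type*} [MeasurableSpace Ω] {μ : Measure Ω} [IsFiniteMeasure μ]

/-- A set is null measurable if measurable subsets exhaust its outer measure. -/
theorem nullMeasurableSet_of_forall_le_add {A : Set Ω}
    (h : ∀ ε : ℝ≥0∞, ε ≠ 0 → ∃ B ⊆ A, MeasurableSet B ∧ μ A ≤ μ B + ε) : NullMeasurableSet A μ := by
  choose B hBA hBm hB using fun n : ℕ => h ((n : ℝ≥0∞) + 1)⁻¹ (by simp)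
  have hle : μ (toMeasurable μ A) ≤ μ (⋃ n, B n) := by
    rw [measure_toMeasurable]
    refine le_of_forall_pos_le_add fun ε hε => ?_
    obtain ⟨n, hn⟩ := ENNReal.exists_inv_nat_lt hε.ne'
    refine (hB n).trans (add_le_add (measure_mono (subset_iUnion B n)) (le_trans ?_ hn.le))
    exact ENNReal.inv_le_inv.2 le_self_add
  have hsub : (⋃ n, B n) ⊆ toMeasurable μ A :=
    (iUnion_subset hBA).trans (subset_toMeasurable μ A)
  have hUm : MeasurableSet (⋃ n, B n) := MeasurableSet.iUnion hBm
  have hae : (⋃ n, B n : Set Ω) =ᵐ[μ] toMeasurable μ A :=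
    ae_eq_of_subset_of_measure_ge hsub hle hUm.nullMeasurableSet (measure_ne_top _ _)
  refine NullMeasurableSet.congr hUm.nullMeasurableSet ?_
  refine Filter.EventuallyLE.antisymm (iUnion_subset hBA).eventuallyLE ?_
  exact (subset_toMeasurable μ A).eventuallyLE.trans hae.symm.le

/-- Capacitability: for a countable intersection of countable unions of random compact sets, the
event that it is nonempty is null measurable, because it is almost exhausted by the events that
the intersection of suitable finite unions is nonempty. -/
theorem nullMeasurableSet_nonempty_iInter_iUnion [TopologicalSpace Z] [T2Space Z]
    (C : ℕ → ℕ → Ω → Set Z) (hC : ∀ j n ω, IsCompact (C j n ω))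
    (hm : ∀ (N : ℕ → ℕ) (j : ℕ),
      MeasurableSet {ω | (⋂ l ∈ Iic j, ⋃ n ∈ Iic (N l), C l n ω).Nonempty}) :
    NullMeasurableSet {ω | (⋂ j, ⋃ n, C j n ω).Nonempty} μ := by
  refine nullMeasurableSet_of_forall_le_add fun ε hε => ?_
  obtain ⟨e, he, hesum⟩ := ENNReal.exists_pos_sum_of_countable hε ℕ
  -- at stage `j`, finitely many of the sets `C j n` suffice up to `e j`
  have step : ∀ (H : {H : Ω → Set Z // ∀ ω, H ω ⊆ ⋂ j, ⋃ n, C j n ω}) (j : ℕ), ∃ k : ℕ,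
      μ {ω | (H.1 ω).Nonempty} ≤ μ {ω | (H.1 ω ∩ ⋃ n ∈ Iic k, C j n ω).Nonempty} + e j := by
    intro H j
    have hmono : Monotone fun k : ℕ => {ω | (H.1 ω ∩ ⋃ n ∈ Iic k, C j n ω).Nonempty} := by
      intro k k' hk ω hω
      refine hω.mono (inter_subset_inter_right _ ?_)
      exact biUnion_subset_biUnion_left (Iic_subset_Iic.2 hk)
    have hU : {ω | (H.1 ω).Nonempty} =
        ⋃ k : ℕ, {ω | (H.1 ω ∩ ⋃ n ∈ Iic k, C j n ω).Nonempty} := by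
      ext ω
      simp only [mem_ofPred_eq, mem_iUnion]
      constructor
      · rintro ⟨z, hz⟩
        obtain ⟨n, hn⟩ := mem_iUnion.1 (mem_iInter.1 (H.2 ω hz) j)
        exact ⟨n, z, hz, mem_biUnion (mem_Iic.2 le_rfl) hn⟩
      · rintro ⟨k, z, hz, -⟩
        exact ⟨z, hz⟩
    have ht := (tendsto_measure_iUnion_atTop (μ := μ) hmono).add_const (e j : ℝ≥0∞)
    rw [← hU] at ht
    have hlt : μ {ω | (H.1 ω).Nonempty} < μ {ω | (H.1 ω).Nonempty} + e j :=
      ENNReal.lt_add_right (measure_ne_top _ _) (by simpa using (he j).ne')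
    obtain ⟨k, hk⟩ := (ht.eventually (lt_mem_nhds hlt)).exists
    exact ⟨k, hk.le⟩
  choose k hk using step
  obtain ⟨H, hH0, hHs⟩ : ∃ H : ℕ → {H : Ω → Set Z // ∀ ω, H ω ⊆ ⋂ j, ⋃ n, C j n ω},
      (H 0).1 = (fun ω => ⋂ j, ⋃ n, C j n ω) ∧
      ∀ j, (H (j + 1)).1 = fun ω => (H j).1 ω ∩ ⋃ n ∈ Iic (k (H j) j), C j n ω :=
    ⟨fun j => Nat.rec ⟨fun ω => ⋂ j, ⋃ n, C j n ω, fun ω => subset_rfl⟩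
      (fun j H => ⟨fun ω => H.1 ω ∩ ⋃ n ∈ Iic (k H j), C j n ω,
        fun ω => inter_subset_left.trans (H.2 ω)⟩) j, rfl, fun _ => rfl⟩
  set N : ℕ → ℕ := fun j => k (H j) j with hN
  have hanti : ∀ ω, Antitone fun j => (H j).1 ω := fun ω =>
    antitone_nat_of_succ_le fun j => by
      rw [hHs]
      exact inter_subset_left
  have hHsub : ∀ j ω, (H (j + 1)).1 ω ⊆ ⋂ l ∈ Iic j, ⋃ n ∈ Iic (N l), C l n ω := by
    intro j ω
    refine subset_iInter₂ fun l hl => (hanti ω (Nat.succ_le_succ hl)).trans ?_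
    change (H (l + 1)).1 ω ⊆ _
    rw [hHs]
    exact inter_subset_right
  have hHμ : ∀ j, μ {ω | (⋂ j, ⋃ n, C j n ω).Nonempty} ≤
      μ {ω | ((H j).1 ω).Nonempty} + ∑ i ∈ Finset.range j, (e i : ℝ≥0∞) := by
    intro j
    induction j with
    | zero => simp [hH0]
    | succ j ih =>
      refine ih.trans ?_
      rw [Finset.sum_range_succ, add_comm (∑ i ∈ Finset.range j, (e i : ℝ≥0∞)), ← add_assoc]
      gcongr
      have := hk (H j) j
      rw [hHs]
      exact this
  set A : ℕ → Set Ω := fun j => {ω | (⋂ l ∈ Iic j, ⋃ n ∈ Iic (N l), C l n ω).Nonempty} with hA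
  have hAanti : Antitone A := fun i j hij ω hω =>
    hω.mono (biInter_subset_biInter_left (Iic_subset_Iic.2 hij))
  have hcomp : ∀ ω j, IsCompact (⋃ n ∈ Iic (N j), C j n ω) := fun ω j =>
    (finite_Iic _).isCompact_biUnion fun n _ => hC j n ω
  refine ⟨⋂ j, A j, fun ω hω => ?_, MeasurableSet.iInter fun j => hm N j, ?_⟩
  · have hne := IsCompact.nonempty_iInter_of_sequence_nonempty_isCompact_isClosed
      (fun j => ⋂ l ∈ Iic j, ⋃ n ∈ Iic (N l), C l n ω)
      (fun j => biInter_subset_biInter_left (Iic_subset_Iic.2 j.le_succ))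
      (fun j => mem_iInter.1 hω j)
      ((hcomp ω 0).of_isClosed_subset
        (isClosed_biInter fun l _ => (hcomp ω l).isClosed)
        (biInter_subset_of_mem (mem_Iic.2 le_rfl)))
      (fun j => isClosed_biInter fun l _ => (hcomp ω l).isClosed)
    refine hne.mono fun z hz => mem_iInter.2 fun j => ?_
    have := mem_iInter₂.1 (mem_iInter.1 hz j) j (mem_Iic.2 le_rfl)
    exact iUnion₂_subset_iUnion _ _ this
  · have hlim := (tendsto_measure_iInter_atTop (μ := μ) (s := A)
      (fun j => (hm N j).nullMeasurableSet) hAanti ⟨0, measure_ne_top _ _⟩).add_const ε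
    refine ge_of_tendsto' hlim fun j => (hHμ (j + 1)).trans (add_le_add (measure_mono ?_) ?_)
    · exact fun ω hω => hω.mono (hHsub j ω)
    · exact (ENNReal.sum_le_tsum _).trans hesum.le

theorem exists_nnrat_btwn_nnreal {a b : ℝ≥0} (h : a < b) :
    ∃ q : ℚ≥0, a < (q : ℝ≥0) ∧ (q : ℝ≥0) < b := by
  obtain ⟨q, h1, h2⟩ := exists_rat_btwn (NNReal.coe_lt_coe.2 h)
  have h0 : (0 : ℝ) ≤ q := (NNReal.coe_nonneg a).trans h1.le
  lift q to ℚ≥0 using by exact_mod_cast h0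
  exact ⟨q, by exact_mod_cast h1, by exact_mod_cast h2⟩

theorem exists_Ico_subset_of_eventually {p : ℝ≥0 → Prop} {u : ℝ≥0} (h : ∀ᶠ r in 𝓝[≥] u, p r) :
    ∃ w, u < w ∧ ∀ r, u ≤ r → r < w → p r := by
  obtain ⟨w, huw, hw⟩ := (mem_nhdsGE_iff_exists_Ico_subset' (lt_add_one u)).1 h
  exact ⟨w, huw, fun r h1 h2 => hw ⟨h1, h2⟩⟩

/-- For a right continuous process, the event that it vanishes at some time in `(0, T)` is null
measurable. -/
theorem nullMeasurableSet_exists_eq_zero (g : ℝ≥0 → Ω → ℝ≥0∞) (T : ℝ≥0)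
    (hg : ∀ r < T, Measurable (g r))
    (hrc : ∀ ω t, ContinuousWithinAt (fun r => g r ω) (Ici t) t) :
    NullMeasurableSet {ω | ∃ u, 0 < u ∧ u < T ∧ g u ω = 0} μ := by
  obtain ⟨v, hv⟩ := exists_surjective_nat (ℚ≥0 × ℚ≥0 × ℚ≥0)
  -- the times `u` in `[a, b]` after which `g` is at most `1 / (j + 1)` up to time `c > b`
  set C : ℕ → ℕ → Ω → Set ℝ≥0 := fun j n ω =>
    {u | (0 < (v n).1 ∧ (v n).2.1 < (v n).2.2 ∧ ((v n).2.2 : ℝ≥0) < T) ∧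
      (((v n).1 : ℝ≥0) ≤ u ∧ u ≤ ((v n).2.1 : ℝ≥0)) ∧
      ∀ r : ℚ≥0, u < r → r < (v n).2.2 → g r ω ≤ ((j : ℝ≥0∞) + 1)⁻¹} with hCdef
  have hC : ∀ j n ω, IsCompact (C j n ω) := by
    intro j n ω
    have hsub : C j n ω ⊆ Icc ((v n).1 : ℝ≥0) ((v n).2.1 : ℝ≥0) := fun u hu => hu.2.1
    refine isCompact_Icc.of_isClosed_subset ?_ hsub
    have : C j n ω = {u | 0 < (v n).1 ∧ (v n).2.1 < (v n).2.2 ∧ ((v n).2.2 : ℝ≥0) < T} ∩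
        (Icc ((v n).1 : ℝ≥0) ((v n).2.1 : ℝ≥0) ∩
        ⋂ (r : ℚ≥0) (_ : r < (v n).2.2 ∧ ¬ g r ω ≤ ((j : ℝ≥0∞) + 1)⁻¹), Ici (r : ℝ≥0)) := by
      ext u
      simp only [hCdef, mem_ofPred_eq, mem_inter_iff, mem_Icc, mem_iInter, mem_Ici]
      refine and_congr_right fun _ => and_congr_right fun _ => forall_congr' fun r => ?_
      rw [← not_lt (a := u)]
      tauto
    rw [this]
    exact isClosed_const.inter (isClosed_Icc.inter
      (isClosed_iInter fun r => isClosed_iInter fun _ => isClosed_Ici))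
  have hup : ∀ j n ω u u', u ∈ C j n ω → u ≤ u' → u' ≤ ((v n).2.1 : ℝ≥0) → u' ∈ C j n ω :=
    fun j n ω u u' hu huu hu' => ⟨hu.1, ⟨hu.2.1.1.trans huu, hu'⟩,
      fun r hr hr' => hu.2.2 r (huu.trans_lt hr) hr'⟩
  have hmu : ∀ j n (u : ℝ≥0), MeasurableSet {ω | u ∈ C j n ω} := by
    intro j n u
    by_cases hT : ((v n).2.2 : ℝ≥0) < T
    · refine (MeasurableSet.const _).inter ((MeasurableSet.const _).inter ?_)
      have : {ω | ∀ r : ℚ≥0, u < r → r < (v n).2.2 → g r ω ≤ ((j : ℝ≥0∞) + 1)⁻¹} =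
          ⋂ (r : ℚ≥0) (_ : u < r) (_ : r < (v n).2.2), {ω | g r ω ≤ ((j : ℝ≥0∞) + 1)⁻¹} := by
        ext ω
        simp
      change MeasurableSet {ω | ∀ r : ℚ≥0, u < r → r < (v n).2.2 → g r ω ≤ ((j : ℝ≥0∞) + 1)⁻¹}
      rw [this]
      refine MeasurableSet.iInter fun r => MeasurableSet.iInter fun _ =>
        MeasurableSet.iInter fun hr => measurableSet_le (hg r (lt_trans ?_ hT)) measurable_const
      exact_mod_cast hr
    · have : {ω | u ∈ C j n ω} = ∅ := by
        ext ω
        simp [hCdef, hT]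
      rw [this]
      exact MeasurableSet.empty
  have key : {ω | ∃ u, 0 < u ∧ u < T ∧ g u ω = 0} = {ω | (⋂ j, ⋃ n, C j n ω).Nonempty} := by
    ext ω
    constructor
    · rintro ⟨u, hu0, huT, hgu⟩
      refine ⟨u, mem_iInter.2 fun j => ?_⟩
      have hpos : g u ω < ((j : ℝ≥0∞) + 1)⁻¹ := by
        rw [hgu]
        simp
      obtain ⟨w, huw, hw⟩ := exists_Ico_subset_of_eventually (hrc ω u |>.eventually
        (gt_mem_nhds hpos))
      obtain ⟨c, huc, hc⟩ := exists_nnrat_btwn_nnreal (lt_min huw huT)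
      obtain ⟨b, hub, hbc⟩ := exists_nnrat_btwn_nnreal huc
      obtain ⟨a, ha0, hau⟩ := exists_nnrat_btwn_nnreal hu0
      obtain ⟨n, hn⟩ := hv (a, b, c)
      refine mem_iUnion.2 ⟨n, ?_⟩
      simp only [hCdef, hn, mem_ofPred_eq]
      refine ⟨⟨by exact_mod_cast ha0, by exact_mod_cast hbc, hc.trans_le (min_le_right _ _)⟩,
        ⟨hau.le, hub.le⟩, fun r hur hrc => (hw r hur.le ?_).le⟩
      exact (NNRat.cast_lt.2 hrc).trans (hc.trans_le (min_le_left _ _))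
    · rintro ⟨u, hu⟩
      rw [mem_iInter] at hu
      obtain ⟨n, hn⟩ := mem_iUnion.1 (hu 0)
      refine ⟨u, lt_of_lt_of_le (by exact_mod_cast hn.1.1) hn.2.1.1,
        lt_trans (lt_of_le_of_lt hn.2.1.2 (by exact_mod_cast hn.1.2.1)) hn.1.2.2, ?_⟩
      by_contra hne
      obtain ⟨j, hj⟩ := ENNReal.exists_inv_nat_lt hne
      have hj' : ((j : ℝ≥0∞) + 1)⁻¹ < g u ω :=
        lt_of_le_of_lt (ENNReal.inv_le_inv.2 le_self_add) hj
      obtain ⟨w, huw, hw⟩ := exists_Ico_subset_of_eventually (hrc ω u |>.eventually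
        (lt_mem_nhds hj'))
      obtain ⟨n, hn⟩ := mem_iUnion.1 (hu j)
      have huc : u < ((v n).2.2 : ℝ≥0) :=
        lt_of_le_of_lt hn.2.1.2 (NNRat.cast_lt.2 hn.1.2.1)
      obtain ⟨r, hur, hr⟩ := exists_nnrat_btwn_nnreal (lt_min huw huc)
      exact absurd (hn.2.2 r hur (NNRat.cast_lt.1 (hr.trans_le (min_le_right _ _))))
        (not_le.2 (hw r hur.le (hr.trans_le (min_le_left _ _))))
  rw [key]
  refine nullMeasurableSet_nonempty_iInter_iUnion C hC fun N j => ?_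
  -- a nonempty such intersection contains the least of the right end points involved
  have : {ω | (⋂ l ∈ Iic j, ⋃ n ∈ Iic (N l), C l n ω).Nonempty} =
      ⋃ b : ℚ≥0, ⋂ l ∈ Iic j, ⋃ n ∈ Iic (N l), {ω | (b : ℝ≥0) ∈ C l n ω} := by
    ext ω
    simp only [mem_ofPred_eq, mem_iUnion, mem_iInter]
    constructor
    · rintro ⟨u, hu⟩
      simp only [mem_iInter, mem_iUnion] at hu
      choose! n hnN hn using hu
      obtain ⟨l₀, hl₀, hmin⟩ := exists_min_image (Iic j) (fun l => (v (n l)).2.1) (finite_Iic j)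
        ⟨j, mem_Iic.2 le_rfl⟩
      refine ⟨(v (n l₀)).2.1, fun l hl => ⟨n l, hnN l hl, ?_⟩⟩
      refine hup _ _ _ u _ (hn l hl) (hn l₀ hl₀).2.1.2 ?_
      exact_mod_cast hmin l hl
    · rintro ⟨b, hb⟩
      refine ⟨b, ?_⟩
      simpa only [mem_iInter, mem_iUnion] using hb
  rw [this]
  exact MeasurableSet.iUnion fun b => MeasurableSet.biInter (to_countable _) fun l _ =>
    MeasurableSet.biUnion (to_countable _) fun n _ => hmu l n _

end Capacity

end

section

/-! ### The exit time -/

variable {d : ℕ} {D : Set (E d)}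

theorem exitTime_lt_iff {ω : Path d} {T : ℝ≥0} :
    exitTime D ω < T ↔ ∃ u, 0 < u ∧ u < T ∧ X u ω ∉ D := by
  simp only [exitTime, iInf_lt_iff, ENNReal.coe_lt_coe, exists_prop]
  constructor
  · rintro ⟨u, ⟨h1, h2⟩, h3⟩
    exact ⟨u, h1, h3, h2⟩
  · rintro ⟨u, h1, h3, h2⟩
    exact ⟨u, ⟨h1, h2⟩, h3⟩

theorem exitTime_le_of_notMem {ω : Path d} {u : ℝ≥0} (hu : 0 < u) (h : X u ω ∉ D) :
    exitTime D ω ≤ u := iInf₂_le u ⟨hu, h⟩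

theorem mem_of_lt_exitTime {ω : Path d} {u : ℝ≥0} (hu : 0 < u) (h : (u : ℝ≥0∞) < exitTime D ω) :
    X u ω ∈ D := by
  by_contra hn
  exact absurd h (not_lt.2 (exitTime_le_of_notMem hu hn))

/-- After `t`, a path that is in the open set `D` at time `t` stays in `D` for a while. -/
theorem exitTime_le_iff (hD : IsOpen D) {ω : Path d} (h0 : X 0 ω ∈ D) (t : ℝ≥0) :
    exitTime D ω ≤ t ↔ (∃ u, 0 < u ∧ u < t ∧ X u ω ∉ D) ∨ X t ω ∉ D := by
  rw [← exitTime_lt_iff]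
  constructor
  · intro h
    by_contra! hc
    obtain ⟨h1, h2⟩ := hc
    obtain ⟨w, htw, hw⟩ := exists_Ico_subset_of_eventually
      ((ω.2 t).1.eventually (hD.mem_nhds h2))
    have : exitTime D ω < w := h.trans_lt (ENNReal.coe_lt_coe.2 htw)
    obtain ⟨u, hu0, huw, huD⟩ := exitTime_lt_iff.1 this
    rcases lt_or_ge u t with hut | hut
    · exact absurd (exitTime_lt_iff.2 ⟨u, hu0, hut, huD⟩) (not_lt.2 h1)
    · exact huD (hw u hut huw)
  · rintro (h | h)
    · exact h.le
    · rcases eq_or_ne t 0 with rfl | ht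
      · exact absurd h0 h
      · exact exitTime_le_of_notMem (pos_iff_ne_zero.2 ht) h

theorem add_lt_exitTime_iff {ω : Path d} {t s : ℝ≥0} :
    ((t + s : ℝ≥0) : ℝ≥0∞) < exitTime D ω ↔
      (t : ℝ≥0∞) < exitTime D ω ∧ (s : ℝ≥0∞) < exitTime D (shift t ω) := by
  constructor
  · intro h
    obtain ⟨c, hc, hc'⟩ := ENNReal.lt_iff_exists_nnreal_btwn.1 h
    rw [ENNReal.coe_lt_coe] at hc
    refine ⟨lt_of_le_of_lt (by simp) h, lt_of_lt_of_le (b := ((c - t : ℝ≥0) : ℝ≥0∞)) ?_ ?_⟩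
    · rw [ENNReal.coe_lt_coe]
      exact lt_tsub_iff_left.2 hc
    · by_contra hlt
      obtain ⟨u, hu0, hu, huD⟩ := exitTime_lt_iff.1 (not_le.1 hlt)
      have h1 : exitTime D ω ≤ ((t + u : ℝ≥0) : ℝ≥0∞) :=
        exitTime_le_of_notMem (by positivity) huD
      have h2 : t + u < c := lt_tsub_iff_left.1 hu
      exact absurd (hc'.trans_le h1) (not_lt.2 (ENNReal.coe_le_coe.2 h2.le))
  · rintro ⟨h1, h2⟩
    obtain ⟨c, hc, hc'⟩ := ENNReal.lt_iff_exists_nnreal_btwn.1 h2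
    rw [ENNReal.coe_lt_coe] at hc
    refine lt_of_lt_of_le (b := ((t + c : ℝ≥0) : ℝ≥0∞)) ?_ ?_
    · rw [ENNReal.coe_lt_coe]
      gcongr
    · by_contra hlt
      obtain ⟨u, hu0, hu, huD⟩ := exitTime_lt_iff.1 (not_le.1 hlt)
      rcases le_or_gt u t with hut | hut
      · exact absurd h1 (not_lt.2 ((exitTime_le_of_notMem hu0 huD).trans
          (ENNReal.coe_le_coe.2 hut)))
      · have h3 : X (u - t) (shift t ω) ∉ D := by
          have : X (u - t) (shift t ω) = X u ω := by
            change ω.1 (t + (u - t)) = ω.1 u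
            rw [add_tsub_cancel_of_le hut.le]
          rwa [this]
        have h4 := exitTime_le_of_notMem (tsub_pos_of_lt hut) h3
        have h5 : u - t < c := by
          rwa [tsub_lt_iff_left hut.le]
        exact absurd (hc'.trans_le h4) (not_lt.2 (ENNReal.coe_le_coe.2 h5.le))

/-- The event of leaving the open set `D` before `T` is null measurable for every finite measure on
any `σ`-algebra with respect to which the process is measurable before time `T`. -/
theorem nullMeasurableSet_exists_notMem {mΩ : MeasurableSpace (Path d)} (hD : IsOpen D)
    (μ : Measure (Path d)) [IsFiniteMeasure μ] (T : ℝ≥0)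
    (hX : ∀ r < T, Measurable (X (d := d) r)) :
    NullMeasurableSet {ω : Path d | ∃ u, 0 < u ∧ u < T ∧ X u ω ∉ D} μ := by
  have h := nullMeasurableSet_exists_eq_zero (μ := μ)
    (fun (r : ℝ≥0) (ω : Path d) => Metric.infEDist (X r ω) Dᶜ) T
    (fun r hr => Metric.continuous_infEDist.measurable.comp (hX r hr))
    (fun ω t => Metric.continuous_infEDist.continuousAt.comp_continuousWithinAt (ω.2 t).1)
  convert h using 6 with ω u
  rw [← Metric.mem_iff_infEDist_zero_of_closed hD.isClosed_compl, mem_compl_iff]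

theorem univMeas_exitTime (hD : IsOpen D) : UnivMeas (exitTime D) := by
  intro μ hμ
  refine NullMeasurable.aemeasurable ?_
  have hT : ∀ T : ℝ≥0, NullMeasurableSet {ω | exitTime D ω < T} μ := fun T => by
    simp_rw [exitTime_lt_iff]
    exact nullMeasurableSet_exists_notMem hD μ T fun r _ => measurable_X r
  refine measurable_of_Iio (α := ℝ≥0∞) (δ := NullMeasurableSpace (Path d) μ) fun x => ?_
  change NullMeasurableSet {ω | exitTime D ω < x} μ
  induction x with
  | coe x => exact hT x
  | top =>
    have : {ω : Path d | exitTime D ω < ⊤} = ⋃ n : ℕ, {ω | exitTime D ω < (n : ℝ≥0)} := by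
      ext ω
      simp only [mem_ofPred_eq, mem_iUnion]
      constructor
      · intro h
        obtain ⟨n, hn⟩ := ENNReal.exists_nat_gt h.ne
        exact ⟨n, by simpa using hn⟩
      · rintro ⟨n, hn⟩
        exact hn.trans_le le_top
    rw [this]
    exact NullMeasurableSet.iUnion fun n => hT n

theorem nullMeasurableSet_lt_exitTime (hD : IsOpen D) (μ : Measure (Path d)) [IsFiniteMeasure μ]
    (t : ℝ≥0) : NullMeasurableSet {ω : Path d | (t : ℝ≥0∞) < exitTime D ω} μ :=
  nullMeasurableSet_lt aemeasurable_const (univMeas_exitTime hD μ inferInstance)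

theorem measurable_X_uncurry : Measurable fun z : ℝ≥0 × Path d => X z.1 z.2 := by
  have hlim : ∀ t : ℝ≥0, Tendsto (fun n : ℕ => ((⌊t * n⌋₊ + 1 : ℕ) : ℝ≥0) / n) atTop (𝓝[≥] t) := by
    intro t
    have hle : ∀ᶠ n : ℕ in atTop, t ≤ ((⌊t * n⌋₊ + 1 : ℕ) : ℝ≥0) / n := by
      filter_upwards [eventually_gt_atTop 0] with n hn
      have hn' : (0 : ℝ≥0) < n := by exact_mod_cast hn
      rw [le_div_iff₀ hn']
      push_cast
      exact (Nat.lt_floor_add_one _).le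
    have hge : ∀ᶠ n : ℕ in atTop, ((⌊t * n⌋₊ + 1 : ℕ) : ℝ≥0) / n ≤ t + (n : ℝ≥0)⁻¹ := by
      filter_upwards [eventually_gt_atTop 0] with n hn
      have hn' : (0 : ℝ≥0) < n := by exact_mod_cast hn
      rw [div_le_iff₀ hn', add_mul, inv_mul_cancel₀ hn'.ne']
      push_cast
      gcongr
      exact Nat.floor_le zero_le
    have hlim : Tendsto (fun n : ℕ => t + (n : ℝ≥0)⁻¹) atTop (𝓝 t) := by
      simpa using (tendsto_inv_atTop_nhds_zero_nat (𝕜 := ℝ≥0)).const_add t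
    exact tendsto_nhdsWithin_iff.2
      ⟨tendsto_of_tendsto_of_tendsto_of_le_of_le' tendsto_const_nhds hlim hle hge, hle⟩
  refine measurable_of_tendsto_metrizable (f := fun (n : ℕ) (z : ℝ≥0 × Path d) =>
    X (((⌊z.1 * n⌋₊ + 1 : ℕ) : ℝ≥0) / n) z.2) (fun n => ?_) ?_
  · have h1 : Measurable fun z : ℕ × Path d => X (((z.1 + 1 : ℕ) : ℝ≥0) / n) z.2 :=
      measurable_from_prod_countable_right fun k => by
        exact measurable_X (d := d) (((k + 1 : ℕ) : ℝ≥0) / n)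
    exact h1.comp (g := fun z : ℕ × Path d => X (((z.1 + 1 : ℕ) : ℝ≥0) / n) z.2)
      (f := fun z : ℝ≥0 × Path d => (⌊z.1 * n⌋₊, z.2))
      ((Nat.measurable_floor.comp (measurable_fst.mul_const _)).prodMk measurable_snd)
  · rw [tendsto_pi_nhds]
    intro z
    exact (z.2.2 z.1).1.tendsto.comp (hlim z.1)

theorem measurable_shift (t : ℝ≥0) : Measurable (shift (d := d) t) :=
  Measurable.subtype_mk (measurable_pi_lambda _ fun r => measurable_X (t + r))

end

section

/-! ### The killed semigroup -/

variable {d : ℕ} {D : Set (E d)}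

/-- Extension by zero from `D` to `ℝ^d`. -/
abbrev extendZero (f : D → ℝ≥0∞) : E d → ℝ≥0∞ := Function.extend Subtype.val f 0

theorem extendZero_coe (f : D → ℝ≥0∞) (x : D) : extendZero f x = f x :=
  Subtype.val_injective.extend_apply _ _ _

theorem extendZero_of_notMem (f : D → ℝ≥0∞) {x : E d} (hx : x ∉ D) : extendZero f x = 0 := by
  rw [extendZero, Function.extend_apply']
  · rfl
  · rintro ⟨y, rfl⟩
    exact hx y.2

theorem indicator_extendZero (f : D → ℝ≥0∞) : D.indicator (extendZero f) = extendZero f := by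
  ext x
  by_cases hx : x ∈ D
  · simp [hx]
  · rw [indicator_of_notMem hx, extendZero_of_notMem f hx]

theorem UnivMeas.extendZero (hD : MeasurableSet D) {f : D → ℝ≥0∞} (hf : UnivMeas f) :
    UnivMeas (extendZero f) := fun μ _ => by
  have hemb := MeasurableEmbedding.subtype_coe hD
  have : IsFiniteMeasure (μ.comap (Subtype.val : D → E d)) := by
    refine ⟨?_⟩
    rw [hemb.comap_apply]
    exact measure_lt_top _ _
  rw [← indicator_extendZero, aemeasurable_indicator_iff hD, ← map_comap_subtype_coe hD,
    hemb.aemeasurable_map_iff]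
  exact (hf (μ.comap Subtype.val) this).congr (ae_of_all _ fun x => (extendZero_coe f x).symm)

/-- The Markov property at the time `t`. -/
theorem map_shift_restrict {P : Kernel (E d) (Path d)} (hP : IsStrongMarkov P) (t : ℝ≥0)
    {Λ : Set (Path d)} (hΛ : MeasurableSet[natFilt d t] Λ) (x : E d) :
    ((P x).restrict Λ).map (shift t) = (((P x).restrict Λ).map (X t)).bind P := by
  have hΛ' : MeasurableSet Λ := (natFilt d).le t _ hΛ
  ext C hC
  rw [Measure.map_apply (measurable_shift t) hC, Measure.restrict_apply (measurable_shift t hC),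
    Measure.bind_apply hC P.measurable.aemeasurable,
    lintegral_map (P.measurable_coe hC) (measurable_X t)]
  have h := hP (fun _ => (t : WithTop ℝ≥0)) (isStoppingTime_const _ t) Λ C
    (by rwa [IsStoppingTime.measurableSpace_const]) hC x
  simp only [ne_eq, WithTop.coe_ne_top, not_false_eq_true, true_and, and_true] at h
  rw [inter_comm]
  exact h

theorem ae_X_zero_eq {P : Kernel (E d) (Path d)}
    (hinit : ∀ x, (P x).map (X 0) = Measure.dirac x) (x : E d) :
    ∀ᵐ ω ∂P x, X 0 ω = x := by
  have h : ∀ᵐ y ∂(P x).map (X 0), y = x := by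
    rw [hinit]
    exact (ae_dirac_iff (p := (· = x)) (measurableSet_singleton x)).2 rfl
  exact ae_of_ae_map (measurable_X 0).aemeasurable h

theorem ae_mem_of_lt_exitTime {P : Kernel (E d) (Path d)}
    (hinit : ∀ x, (P x).map (X 0) = Measure.dirac x) (t : ℝ≥0) (x : D) :
    ∀ᵐ ω ∂P x, (t : ℝ≥0∞) < exitTime D ω → X t ω ∈ D := by
  filter_upwards [ae_X_zero_eq hinit (x : E d)] with ω h0 h
  rcases eq_or_ne t 0 with rfl | ht
  · rw [h0]
    exact x.2
  · exact mem_of_lt_exitTime (pos_iff_ne_zero.2 ht) h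

variable (P : Kernel (E d) (Path d))

/-- The law of `X_t` on `{t < τ_D}` under `P_x`, as a measure on `D`. -/
def killedMeasure (D : Set (E d)) (t : ℝ≥0) (x : D) : Measure D :=
  (((P x).restrict {ω | (t : ℝ≥0∞) < exitTime D ω}).map (X t)).comap Subtype.val

variable [IsMarkovKernel P]

theorem killedMeasure_univ_le (hD : MeasurableSet D) (t : ℝ≥0) (x : D) :
    killedMeasure P D t x univ ≤ 1 := by
  rw [killedMeasure, (MeasurableEmbedding.subtype_coe hD).comap_apply, image_univ,
    Subtype.range_coe, Measure.map_apply (measurable_X t) hD]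
  exact (Measure.restrict_le_self _).trans prob_le_one

theorem killed_eq_lintegral (hD : MeasurableSet D) (t : ℝ≥0) {f : D → ℝ≥0∞} (hf : UnivMeas f)
    (x : D) : killed P D t f x = ∫⁻ y, f y ∂killedMeasure P D t x := by
  have h1 : ∀ μ : Measure (E d), ∫⁻ y : D, f y ∂μ.comap Subtype.val = ∫⁻ y, extendZero f y ∂μ := by
    intro μ
    rw [← indicator_extendZero, lintegral_indicator hD, ← lintegral_subtype_comap hD]
    exact lintegral_congr fun y => (extendZero_coe f y).symm
  rw [killedMeasure, h1, lintegral_map' (hf.extendZero hD _ inferInstance)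
    (measurable_X t).aemeasurable]
  rfl

/-- Joint universal measurability of the killed transition probabilities: for a finite measure on
`[0, ∞) × D`, the exit time may be replaced by a measurable function that agrees with it almost
surely under the induced mixture of the laws `P_x`. -/
theorem univMeas_killedMeasure (hD : IsOpen D) :
    UnivMeas fun z : ℝ≥0 × D => killedMeasure P D z.1 z.2 := fun μ hμ => by
  set k : Kernel (ℝ≥0 × D) (Path d) := P.comap (fun z : ℝ≥0 × D => (z.2 : E d)) (by fun_prop)
    with hk
  have hτ : AEMeasurable (exitTime D) (μ.bind k) := univMeas_exitTime hD _ inferInstance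
  set σ := hτ.mk (exitTime D) with hσ
  have hσm : Measurable σ := hτ.measurable_mk
  have hae : ∀ᵐ z ∂μ, ∀ᵐ ω ∂P z.2, exitTime D ω = σ ω :=
    Measure.ae_ae_of_ae_bind k.measurable.aemeasurable hτ.ae_eq_mk
  have hmeas : Measurable fun z : ℝ≥0 × D =>
      (((P z.2).restrict {ω | (z.1 : ℝ≥0∞) < σ ω}).map (X z.1)).comap
        (Subtype.val : D → E d) := by
    refine Measure.measurable_of_measurable_coe _ fun B hB => ?_
    have hB' : MeasurableSet (Subtype.val '' B : Set (E d)) := hD.measurableSet.subtype_image hB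
    have heq : ∀ z : ℝ≥0 × D, (((P z.2).restrict {ω | (z.1 : ℝ≥0∞) < σ ω}).map (X z.1)).comap
        (Subtype.val : D → E d) B = k z (Prod.mk z ⁻¹' {p : (ℝ≥0 × D) × Path d |
          X p.1.1 p.2 ∈ (Subtype.val '' B : Set (E d)) ∧ (p.1.1 : ℝ≥0∞) < σ p.2}) := by
      intro z
      rw [(MeasurableEmbedding.subtype_coe hD.measurableSet).comap_apply,
        Measure.map_apply (measurable_X _) hB', Measure.restrict_apply (measurable_X _ hB')]
      rfl
    simp_rw [heq]
    refine Kernel.measurable_kernel_prodMk_left (MeasurableSet.inter ?_ ?_)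
    · exact (measurable_X_uncurry.comp
        (g := fun z : ℝ≥0 × Path d => X z.1 z.2)
        (f := fun p : (ℝ≥0 × D) × Path d => (p.1.1, p.2)) (by fun_prop)) hB'
    · exact measurableSet_lt (by fun_prop) (hσm.comp measurable_snd)
  refine hmeas.aemeasurable.congr ?_
  filter_upwards [hae] with z hz
  rw [killedMeasure]
  congr 2
  refine Measure.restrict_congr_set ?_
  filter_upwards [hz] with ω hω
  refine propext ?_
  change (z.1 : ℝ≥0∞) < σ ω ↔ (z.1 : ℝ≥0∞) < exitTime D ω
  rw [hω]

variable {P}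

/-- The event `{t < τ_D}` belongs to `ℱ_t` up to a null set. -/
theorem exists_natFilt_ae_eq (hD : IsOpen D)
    (hinit : ∀ x, (P x).map (X 0) = Measure.dirac x) (t : ℝ≥0) (x : D) :
    ∃ Λ, MeasurableSet[natFilt d t] Λ ∧
      {ω : Path d | (t : ℝ≥0∞) < exitTime D ω} =ᵐ[P x] Λ := by
  have hle : natFilt d t ≤ (inferInstance : MeasurableSpace (Path d)) := (natFilt d).le t
  have hX : ∀ r ≤ t, Measurable[natFilt d t] (X (d := d) r) := fun r hr =>
    ((Filtration.stronglyAdapted_natural fun t => (measurable_X (d := d) t).stronglyMeasurable)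
      r).measurable.mono ((natFilt d).mono hr) le_rfl
  have : IsFiniteMeasure ((P (x : E d)).trim hle) := isFiniteMeasure_trim hle
  -- applied to the trimmed measure, so that the measurable hull lies in `ℱ_t`
  have hnull := @nullMeasurableSet_exists_notMem d D (natFilt d t) hD ((P (x : E d)).trim hle)
    this t fun r hr => hX r hr.le
  obtain ⟨B, -, hBm, hB⟩ := hnull.exists_measurable_superset_ae_eq
  refine ⟨(B ∪ X t ⁻¹' Dᶜ)ᶜ,
    (hBm.union (hX t le_rfl hD.isClosed_compl.measurableSet)).compl, ?_⟩
  have hB' := ae_eq_of_ae_eq_trim hB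
  filter_upwards [hB', ae_X_zero_eq hinit (x : E d)] with ω hω h0
  have h1 : ω ∈ B ↔ ∃ u, 0 < u ∧ u < t ∧ X u ω ∉ D := iff_of_eq hω
  have h2 := exitTime_le_iff hD (ω := ω) (by rw [h0]; exact x.2) t
  refine propext ?_
  change (t : ℝ≥0∞) < exitTime D ω ↔ ¬ (ω ∈ B ∨ X t ω ∉ D)
  rw [h1, ← h2, not_le]

/-- The Chapman–Kolmogorov equation for the killed semigroup. -/
theorem killed_add (hD : IsOpen D) (hinit : ∀ x, (P x).map (X 0) = Measure.dirac x)
    (hP : IsStrongMarkov P) (t s : ℝ≥0) {f : D → ℝ≥0∞} (hf : UnivMeas f) (x : D) :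
    killed P D (t + s) f x = killed P D t (killed P D s f) x := by
  set A : ℝ≥0 → Set (Path d) := fun t => {ω | (t : ℝ≥0∞) < exitTime D ω} with hA
  have hAn : ∀ (t : ℝ≥0) (μ : Measure (Path d)) [IsFiniteMeasure μ], NullMeasurableSet (A t) μ :=
    fun t μ _ => nullMeasurableSet_lt_exitTime hD μ t
  set F : Path d → ℝ≥0∞ := fun ω => extendZero f (X s ω) with hF
  have hFm : UnivMeas F := (hf.extendZero hD.measurableSet).comp_measurable (measurable_X s)
  have hGm : UnivMeas ((A s).indicator F) := fun μ hμ => (hFm μ hμ).indicator₀ (hAn s μ)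
  have hPG : UnivMeas fun y => ∫⁻ ω, (A s).indicator F ω ∂P y :=
    P.measurable.univMeas.lintegral (fun y => prob_le_one) hGm
  obtain ⟨Λ, hΛ, hAΛ⟩ := exists_natFilt_ae_eq hD hinit t x
  have hΛ' : MeasurableSet Λ := (natFilt d).le t _ hΛ
  calc killed P D (t + s) f x
      = ∫⁻ ω in A (t + s), extendZero f (X (t + s) ω) ∂P x := rfl
    _ = ∫⁻ ω in A t, (A s).indicator F (shift t ω) ∂P x := by
        rw [← lintegral_indicator₀ (hAn _ _), ← lintegral_indicator₀ (hAn _ _)]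
        refine lintegral_congr fun ω => ?_
        have hiff : ω ∈ A (t + s) ↔ ω ∈ A t ∧ shift t ω ∈ A s := add_lt_exitTime_iff
        by_cases h1 : ω ∈ A t
        · by_cases h2 : shift t ω ∈ A s
          · rw [indicator_of_mem (hiff.2 ⟨h1, h2⟩), indicator_of_mem h1, indicator_of_mem h2]
            rfl
          · rw [indicator_of_notMem (fun h => h2 (hiff.1 h).2), indicator_of_mem h1,
              indicator_of_notMem h2]
        · rw [indicator_of_notMem (fun h => h1 (hiff.1 h).1), indicator_of_notMem h1]
    _ = ∫⁻ ω, (A s).indicator F ω ∂((P x).restrict Λ).map (shift t) := by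
        rw [Measure.restrict_congr_set hAΛ,
          lintegral_map' (hGm _ inferInstance) (measurable_shift t).aemeasurable]
    _ = ∫⁻ ω in Λ, ∫⁻ ω', (A s).indicator F ω' ∂P (X t ω) ∂P x := by
        rw [map_shift_restrict hP t hΛ x,
          P.measurable.univMeas.lintegral_bind (fun y => prob_le_one) hGm,
          lintegral_map' (hPG _ inferInstance) (measurable_X t).aemeasurable]
    _ = ∫⁻ ω in A t, ∫⁻ ω', (A s).indicator F ω' ∂P (X t ω) ∂P x := by
        rw [Measure.restrict_congr_set hAΛ]
    _ = ∫⁻ ω in A t, extendZero (killed P D s f) (X t ω) ∂P x := by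
        refine lintegral_congr_ae ?_
        filter_upwards [ae_restrict_mem₀ (hAn t (P x)),
          ae_restrict_of_ae (ae_mem_of_lt_exitTime hinit t x)] with ω h1 h2
        rw [lintegral_indicator₀ (hAn s _)]
        exact (extendZero_coe (killed P D s f) ⟨X t ω, h2 h1⟩).symm
    _ = killed P D t (killed P D s f) x := rfl

theorem tendsto_lt_exitTime (hD : IsOpen D) (hET : ExitFinite P D) (x : D) :
    Tendsto (fun n : ℕ => P x {ω | ((n : ℝ≥0) : ℝ≥0∞) < exitTime D ω}) atTop (𝓝 0) := by
  have h := tendsto_measure_iInter_atTop (μ := P (x : E d))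
    (s := fun n : ℕ => {ω | ((n : ℝ≥0) : ℝ≥0∞) < exitTime D ω})
    (fun n => nullMeasurableSet_lt_exitTime hD _ _)
    (fun i j hij ω hω => lt_of_le_of_lt (ENNReal.coe_le_coe.2 (Nat.cast_le.2 hij)) hω)
    ⟨0, measure_ne_top _ _⟩
  have h0 : P x (⋂ n : ℕ, {ω | ((n : ℝ≥0) : ℝ≥0∞) < exitTime D ω}) = 0 := by
    refine measure_mono_null ?_ (ae_iff.1 (hET x x.2))
    intro ω hω hlt
    obtain ⟨n, hn⟩ := ENNReal.exists_nat_gt hlt.ne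
    have := mem_iInter.1 hω n
    simp only [mem_ofPred_eq, ENNReal.coe_natCast] at this
    exact absurd hn (not_lt.2 this.le)
  rwa [h0] at h

end

section

/-! ### The eigenfunction -/

variable {d : ℕ} {D : Set (E d)} {P : Kernel (E d) (Path d)} {m : Measure D} {φ : D → ℝ≥0}
  {lam : ℝ}

theorem IsEigen.pos_of_irred (hEig : IsEigen P D m φ lam) (hIR : Irred P D m)
    (hφ : ∃ M : ℝ≥0, ∀ x, φ x ≤ M) (x : D) : φ x ≠ 0 := by
  intro h0
  have h := hIR φ ⟨hEig.measurable, hφ⟩ hEig.pos x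
  refine h.ne' ?_
  rw [killedResolvent, resolvent]
  simp_rw [← hEig.eigen]
  simp [h0]

/-- Since `φ` is bounded and `τ_D < ∞`, the eigenvalue cannot vanish: `P^D_t φ → 0`. -/
theorem IsEigen.lam_pos [IsMarkovKernel P] (hEig : IsEigen P D m φ lam) (hD : IsOpen D)
    (hET : ExitFinite P D) (hφ : ∃ M : ℝ≥0, ∀ x, φ x ≤ M) {x : D} (hx : φ x ≠ 0) : 0 < lam := by
  refine lt_of_le_of_ne hEig.lam_nonneg fun h0 => hx ?_
  obtain ⟨M, hM⟩ := hφ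
  have hle : ∀ n : ℕ, (φ x : ℝ≥0∞) ≤ M * P x {ω | ((n : ℝ≥0) : ℝ≥0∞) < exitTime D ω} := by
    intro n
    have h := hEig.eigen n x
    rw [← h0] at h
    simp only [zero_mul, neg_zero, Real.exp_zero, ENNReal.ofReal_one, one_mul] at h
    rw [h, ← setLIntegral_const]
    refine lintegral_mono fun ω => ?_
    by_cases hω : X n ω ∈ D
    · have := extendZero_coe (fun y => (φ y : ℝ≥0∞)) ⟨X n ω, hω⟩
      exact this.le.trans (ENNReal.coe_le_coe.2 (hM _))
    · exact (extendZero_of_notMem (fun y => (φ y : ℝ≥0∞)) hω).le.trans zero_le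
  have hlim := ENNReal.Tendsto.const_mul (tendsto_lt_exitTime hD hET x) (a := (M : ℝ≥0∞))
    (Or.inr ENNReal.coe_ne_top)
  rw [mul_zero] at hlim
  have := ge_of_tendsto' hlim hle
  simpa using this

/-! ### The `φ`-process -/

variable (P φ lam) in
/-- The transition probabilities of the `φ`-process. -/
def doobMeasure (t : ℝ≥0) (x : D) : Measure D :=
  (ENNReal.ofReal (Real.exp (lam * t)) / φ x) •
    (killedMeasure P D t x).withDensity fun y => φ y

theorem killed_const_mul [IsMarkovKernel P] (hD : MeasurableSet D) (t : ℝ≥0) (c : ℝ≥0∞)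
    {f : D → ℝ≥0∞} (hf : UnivMeas f) (x : D) :
    killed P D t (fun y => c * f y) x = c * killed P D t f x := by
  have hfin : IsFiniteMeasure (killedMeasure P D t x) :=
    ⟨(killedMeasure_univ_le P hD t x).trans_lt ENNReal.one_lt_top⟩
  rw [killed_eq_lintegral P hD t hf, killed_eq_lintegral P hD t (measurable_const.univMeas.mul hf),
    lintegral_const_mul'' _ (hf _ inferInstance)]

theorem univMeas_killed [IsMarkovKernel P] (hD : IsOpen D) (t : ℝ≥0) {f : D → ℝ≥0∞}
    (hf : UnivMeas f) :
    UnivMeas (killed P D t f) := by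
  have : killed P D t f = fun x => ∫⁻ y, f y ∂killedMeasure P D t x :=
    funext fun x => killed_eq_lintegral P hD.measurableSet t hf x
  rw [this]
  exact ((univMeas_killedMeasure P hD).comp_measurable
    (g := fun x : D => (t, x)) (by fun_prop)).lintegral
    (killedMeasure_univ_le P hD.measurableSet t) hf

theorem univMeas_doobMeasure [IsMarkovKernel P] (hD : IsOpen D) (hφm : Measurable φ) :
    UnivMeas fun z : ℝ≥0 × D => doobMeasure P φ lam z.1 z.2 := fun μ hμ => by
  have h := univMeas_killedMeasure P hD μ hμ
  set p := h.mk (fun z : ℝ≥0 × D => killedMeasure P D z.1 z.2) with hp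
  have hpm : Measurable p := h.measurable_mk
  have hmeas : Measurable fun z : ℝ≥0 × D =>
      (ENNReal.ofReal (Real.exp (lam * z.1)) / φ z.2) • (p z).withDensity fun y => φ y := by
    refine Measure.measurable_of_measurable_coe _ fun B hB => ?_
    have heq : ∀ z : ℝ≥0 × D, ((ENNReal.ofReal (Real.exp (lam * z.1)) / φ z.2) •
        (p z).withDensity fun y => (φ y : ℝ≥0∞)) B = (ENNReal.ofReal (Real.exp (lam * z.1)) / φ z.2)
        * ∫⁻ y, B.indicator (fun y => (φ y : ℝ≥0∞)) y ∂p z := fun z => by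
      rw [Measure.smul_apply, withDensity_apply _ hB, lintegral_indicator hB, smul_eq_mul]
    simp_rw [heq]
    refine Measurable.mul (by fun_prop) ?_
    exact (Measure.measurable_lintegral
      (hφm.coe_nnreal_ennreal.indicator hB)).comp hpm
  refine hmeas.aemeasurable.congr ?_
  filter_upwards [h.ae_eq_mk] with z hz
  rw [doobMeasure, hz]

theorem doob_eq_lintegral [IsMarkovKernel P] (hD : MeasurableSet D) (hφm : Measurable φ)
    (t : ℝ≥0) {f : D → ℝ≥0∞} (hf : UnivMeas f) (x : D) :
    doob P D φ lam t f x = ∫⁻ y, f y ∂doobMeasure P φ lam t x := by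
  have hfin : IsFiniteMeasure (killedMeasure P D t x) :=
    ⟨(killedMeasure_univ_le P hD t x).trans_lt ENNReal.one_lt_top⟩
  have hφ' := hφm.coe_nnreal_ennreal
  rw [doobMeasure, lintegral_smul_measure,
    lintegral_withDensity_eq_lintegral_mul₀ hφ'.aemeasurable (hf _ inferInstance), doob,
    killed_eq_lintegral P hD t (hf.mul hφ'.univMeas), ENNReal.mul_div_right_comm, smul_eq_mul]
  congr 1
  exact lintegral_congr fun y => mul_comm _ _

/-- The `φ`-process is a conservative Markov process. -/
theorem IsEigen.univMarkovSemigroup [IsMarkovKernel P] (hEig : IsEigen P D m φ lam) (hD : IsOpen D)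
    (hinit : ∀ x, (P x).map (X 0) = Measure.dirac x) (hP : IsStrongMarkov P)
    (hφ0 : ∀ x, φ x ≠ 0) :
    UnivMarkovSemigroup (doob P D φ lam) (doobMeasure P φ lam) where
  represents t :=
    { prob := fun x => by
        refine ⟨?_⟩
        have h := doob_eq_lintegral (lam := lam) (P := P) hD.measurableSet hEig.measurable t
          (measurable_one.univMeas) x
        simp only [Pi.one_apply, lintegral_one] at h
        rw [← h, doob]
        simp only [Pi.one_apply, one_mul]
        rw [← hEig.eigen, ← mul_assoc, ← ENNReal.ofReal_mul (Real.exp_pos _).le, ← Real.exp_add,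
          add_neg_cancel, Real.exp_zero, ENNReal.ofReal_one, one_mul]
        exact ENNReal.div_self (by simpa using hφ0 x) ENNReal.coe_ne_top
      univMeas := (univMeas_doobMeasure hD hEig.measurable).comp_measurable
        (g := fun x : D => (t, x)) (by fun_prop)
      eq := fun f hf x => doob_eq_lintegral hD.measurableSet hEig.measurable t hf x }
  univMeas := univMeas_doobMeasure hD hEig.measurable
  comp s t f hf x := by
    have hfφ : UnivMeas fun y => f y * φ y := hf.mul hEig.measurable.coe_nnreal_ennreal.univMeas
    have h1 : (fun y => doob P D φ lam t f y * φ y) =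
        fun y => ENNReal.ofReal (Real.exp (lam * t)) * killed P D t (fun y => f y * φ y) y := by
      ext y
      rw [doob, ENNReal.div_mul_cancel (by simpa using hφ0 y) ENNReal.coe_ne_top]
    rw [doob, doob, h1, killed_const_mul hD.measurableSet s _ (univMeas_killed hD t hfφ),
      killed_add hD hinit hP s t hfφ, ← mul_assoc, ← ENNReal.ofReal_mul (Real.exp_pos _).le,
      ← Real.exp_add, NNReal.coe_add, mul_add]

/-- `U_{α+lam} f = φ⁻¹ R^D_α (f φ)`. -/
theorem resolvent_doob (α : ℝ) {x : D} (hx : φ x ≠ 0) (f : D → ℝ≥0∞) :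
    resolvent (doob P D φ lam) (α + lam) f x =
      killedResolvent P D α (fun y => f y * φ y) x / φ x := by
  rw [killedResolvent, resolvent, resolvent, ENNReal.div_eq_inv_mul, mul_comm,
    ← lintegral_mul_const' _ _ (by simpa using hx)]
  refine setLIntegral_congr_fun measurableSet_Ioi fun t ht => ?_
  have ht' : (0 : ℝ) ≤ t := (mem_Ioi.1 ht).le
  simp only [doob]
  rw [Real.coe_toNNReal _ ht', ENNReal.div_eq_inv_mul, mul_comm (φ x : ℝ≥0∞)⁻¹, ← mul_assoc,
    ← mul_assoc, ← ENNReal.ofReal_mul (Real.exp_pos _).le, ← Real.exp_add]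
  congr 4
  ring

theorem resolvent_doob_div (α : ℝ) (hφ0 : ∀ x, φ x ≠ 0) (f : D → ℝ≥0∞) (x : D) :
    resolvent (doob P D φ lam) (α + lam) (fun y => f y / φ y) x =
      killedResolvent P D α f x / φ x := by
  rw [resolvent_doob α (hφ0 x)]
  congr 2
  ext y
  exact ENNReal.div_mul_cancel (by simpa using hφ0 y) ENNReal.coe_ne_top

/-! ### Minorization and uniform ergodicity -/

/-- A lower bound of the resolvent of the `φ`-process by its mean under `η` translates into
the minorization condition; irreducibility shows that `m` is absolutely continuous with respect to
the minorizing measure. -/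
theorem exists_minorization_of_le_resolvent (hEig : IsEigen P D m φ lam) (hIR : Irred P D m)
    (hφ0 : ∀ x, φ x ≠ 0) (hT : UnivMarkovSemigroup (doob P D φ lam) (doobMeasure P φ lam))
    {α : ℝ} (hα : 0 < α + lam) {η : Measure D} [IsFiniteMeasure η] (hη : η ≠ 0) {c : ℝ≥0∞}
    (hc : c ≠ ⊤) (hle : ∀ f, UnivMeas f → ∀ x,
      ∫⁻ y, resolvent (doob P D φ lam) (α + lam) f y ∂η ≤
        c * resolvent (doob P D φ lam) (α + lam) f x) :
    ∃ ν : Measure D, Minorization P D φ α ν ∧ m ≪ ν := by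
  set U := resolvent (doob P D φ lam) (α + lam) with hU
  have hφm := hEig.measurable.coe_nnreal_ennreal
  have hφi : Measurable fun y => (φ y : ℝ≥0∞)⁻¹ := hφm.inv
  have hrep := hT.represents_resolvent hα
  set κ := fun x => (expLaw (α + lam)).bind fun t => doobMeasure P φ lam t.toNNReal x with hκ
  set b := ENNReal.ofReal (α + lam) with hb
  have hb0 : b ≠ 0 := by simpa [hb] using hα
  have hbt : b ≠ ⊤ := by simp [hb]
  -- adding `1` keeps the normalizing constant away from `0`
  set c₁ := c * b + 1 with hc₁
  have hc₁0 : c₁ ≠ 0 := by simp [hc₁]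
  have hc₁t : c₁ ≠ ⊤ := ENNReal.add_ne_top.2 ⟨ENNReal.mul_ne_top hc hbt, by simp⟩
  set ν : Measure D := c₁⁻¹ • (η.bind κ).withDensity fun y => (φ y : ℝ≥0∞)⁻¹ with hν
  have hνf : ∀ f : D → ℝ≥0∞, Measurable f →
      ∫⁻ y, f y ∂ν = c₁⁻¹ * (b * ∫⁻ y, U (fun z => f z / φ z) y ∂η) := by
    intro f hf
    have hfφ : UnivMeas fun z => f z / φ z := (hf.div hφm).univMeas
    rw [hν, lintegral_smul_measure, lintegral_withDensity_eq_lintegral_mul _ hφi hf,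
      smul_eq_mul, ← lintegral_const_mul'' _ (hT.univMeas_resolvent _ hfφ _ inferInstance)]
    congr 1
    have h2 : (fun y => ((fun y => (φ y : ℝ≥0∞)⁻¹) * f) y) = fun z => f z / φ z := by
      ext y
      rw [Pi.mul_apply, ENNReal.div_eq_inv_mul]
    rw [h2, hrep.univMeas.lintegral_bind hrep.le_one hfφ]
    exact lintegral_congr fun x => (hrep.eq _ hfφ x).symm
  have hac : m ≪ ν := by
    refine Measure.AbsolutelyContinuous.mk fun B hB hνB => ?_
    by_contra hmB
    set g : D → ℝ≥0 := B.indicator 1 with hg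
    have hgm : Measurable g := measurable_one.indicator hB
    have hg1 : (fun y => (g y : ℝ≥0∞)) = B.indicator 1 := by
      ext y
      by_cases hy : y ∈ B <;> simp [hg, hy]
    have hgb : IsBbPos g := ⟨hgm, 1, fun y => by by_cases hy : y ∈ B <;> simp [hg, hy]⟩
    have hgφ : UnivMeas fun z => (g z : ℝ≥0∞) / φ z :=
      (hgm.coe_nnreal_ennreal.div hφm).univMeas
    have hpos : 0 < ∫⁻ y, g y ∂m := by
      rw [hg1, lintegral_indicator_one hB]
      exact pos_iff_ne_zero.2 hmB
    have hUpos : ∀ x, U (fun z => (g z : ℝ≥0∞) / φ z) x ≠ 0 := by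
      intro x h0
      rw [hU, hT.resolvent_eq_zero_iff _ hgφ, ← hT.resolvent_eq_zero_iff (1 + lam) hgφ,
        resolvent_doob_div 1 hφ0, ENNReal.div_eq_zero_iff] at h0
      exact h0.elim (hIR g hgb hpos x).ne' ENNReal.coe_ne_top
    have h1 : ∫⁻ y, (g y : ℝ≥0∞) ∂ν = 0 := by rw [hg1, lintegral_indicator_one hB, hνB]
    rw [hνf _ hgm.coe_nnreal_ennreal, mul_eq_zero, mul_eq_zero,
      lintegral_eq_zero_iff' (hT.univMeas_resolvent _ hgφ _ inferInstance)] at h1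
    rcases h1 with h1 | h1 | h1
    · exact hc₁t (ENNReal.inv_eq_zero.1 h1)
    · exact hb0 h1
    · refine hη (ae_eq_bot.1 ?_)
      rw [← empty_mem_iff_bot]
      filter_upwards [h1] with x hx using hUpos x hx
  refine ⟨ν, ⟨fun h0 => ?_, fun f hf x => ?_⟩, hac⟩
  · have hm0 : m = 0 := Measure.absolutelyContinuous_zero_iff.1 (h0 ▸ hac)
    have := hEig.pos
    simp [hm0] at this
  · have hfφ : UnivMeas fun z => (f z : ℝ≥0∞) / φ z :=
      (hf.1.coe_nnreal_ennreal.div hφm).univMeas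
    have hx0 : (φ x : ℝ≥0∞) ≠ 0 := by simpa using hφ0 x
    have h1 : ∫⁻ y, (f y : ℝ≥0∞) ∂ν ≤ U (fun z => (f z : ℝ≥0∞) / φ z) x := by
      rw [hνf _ hf.1.coe_nnreal_ennreal]
      set u := U (fun z => (f z : ℝ≥0∞) / φ z) x with hu
      calc c₁⁻¹ * (b * ∫⁻ y, U (fun z => (f z : ℝ≥0∞) / φ z) y ∂η)
          ≤ c₁⁻¹ * (b * (c * u)) := by
            gcongr
            exact hle _ hfφ x
        _ = c₁⁻¹ * ((c * b) * u) := by ring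
        _ ≤ c₁⁻¹ * (c₁ * u) := by
            gcongr
            exact le_self_add
        _ = u := by rw [← mul_assoc, ENNReal.inv_mul_cancel hc₁0 hc₁t, one_mul]
    rw [hU, resolvent_doob_div α hφ0] at h1
    calc (φ x : ℝ≥0∞) * ∫⁻ y, f y ∂ν
        ≤ φ x * (killedResolvent P D α (fun y => f y) x / φ x) := by gcongr
      _ = _ := ENNReal.mul_div_cancel hx0 ENNReal.coe_ne_top

/-- The minorization conditions give Doeblin's condition for the chains `α U_α`. -/
theorem unifErgResolvent_of_minorization [Nonempty D] (hEig : IsEigen P D m φ lam)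
    (hφ : ∃ M : ℝ≥0, ∀ x, φ x ≤ M) (hφ0 : ∀ x, φ x ≠ 0)
    (hT : UnivMarkovSemigroup (doob P D φ lam) (doobMeasure P φ lam))
    (h : ∀ α : ℝ, 0 ≤ α → ∃ ν : Measure D, Minorization P D φ α ν) :
    UnifErgResolvent (doob P D φ lam) := by
  intro α hα
  -- `U_α ≥ U_{α' + lam}` for `α' = max (α - lam) 0`
  obtain ⟨ν, hν0, hν⟩ := h (max (α - lam) 0) (le_max_right _ _)
  have hφm := hEig.measurable.coe_nnreal_ennreal
  have hrep := hT.represents_resolvent hα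
  have hle : α ≤ max (α - lam) 0 + lam := by linarith [le_max_left (α - lam) 0]
  refine hrep.unifErgChain (η := ENNReal.ofReal α • ν.withDensity fun y => φ y) ?_ fun x => ?_
  · intro h0
    have h1 : (ENNReal.ofReal α • ν.withDensity fun y => (φ y : ℝ≥0∞)) univ = 0 := by rw [h0]; rfl
    rw [Measure.smul_apply, withDensity_apply _ MeasurableSet.univ, setLIntegral_univ, smul_eq_mul,
      mul_eq_zero, lintegral_eq_zero_iff hφm] at h1
    rcases h1 with h1 | h1
    · exact absurd h1 (by simpa using hα)
    · refine hν0 (ae_eq_bot.1 ?_)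
      rw [← empty_mem_iff_bot]
      filter_upwards [h1] with x hx using hφ0 x (by simpa using hx)
  · refine Measure.le_iff.2 fun B hB => ?_
    have h1 := hrep.eq (B.indicator 1) (measurable_one.indicator hB).univMeas x
    rw [lintegral_indicator_one hB] at h1
    rw [← h1, Measure.smul_apply, smul_eq_mul]
    gcongr
    refine le_trans ?_ (resolvent_antitone _ hle _ x)
    obtain ⟨M, hM⟩ := hφ
    have h2 := hν (B.indicator φ) ⟨hEig.measurable.indicator hB, M, fun y => by
      by_cases hy : y ∈ B <;> simp [hy, hM y]⟩ x
    have h3 : (fun y => ((B.indicator φ y : ℝ≥0) : ℝ≥0∞)) = B.indicator fun y => (φ y : ℝ≥0∞) := by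
      ext y
      by_cases hy : y ∈ B <;> simp [hy]
    have h4 : (fun y => B.indicator (1 : D → ℝ≥0∞) y * φ y) =
        B.indicator fun y => (φ y : ℝ≥0∞) := by
      ext y
      by_cases hy : y ∈ B <;> simp [hy]
    rw [h3, lintegral_indicator hB] at h2
    rw [resolvent_doob _ (hφ0 x), h4, withDensity_apply _ hB,
      ENNReal.le_div_iff_mul_le (Or.inl (by simpa using hφ0 x)) (Or.inl ENNReal.coe_ne_top),
      mul_comm]
    exact h2

end

end LevyHopf

end

theorem theorem4p3 (d : ℕ) (D : Set (LevyHopf.E d)) (hD : IsOpen D) (hDconn : IsConnected D)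
    (A : LevyHopf.Coeff d) (hA1 : A.LocalHyp D) (hA2 : A.JumpHyp)
    (P : Kernel (LevyHopf.E d) (LevyHopf.Path d)) (hA4 : LevyHopf.IsStrongMarkovSol A P)
    (hET : LevyHopf.ExitFinite P D)
    (m : Measure D) (hm : SigmaFinite m) (hIR : LevyHopf.Irred P D m)
    (φ : D → ℝ≥0) (lam : ℝ) (hEig : LevyHopf.IsEigen P D m φ lam)
    (hφ : ∃ M : ℝ≥0, ∀ x, φ x ≤ M) :
    ((∀ α : ℝ, 0 ≤ α → ∃ ν : Measure D, LevyHopf.Minorization P D φ α ν) ↔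
        LevyHopf.UnifErgResolvent (LevyHopf.doob P D φ lam)) ∧
      (LevyHopf.UnifErgSemigroup (LevyHopf.doob P D φ lam) →
        ∀ α : ℝ, 0 ≤ α → ∃ ν : Measure D, LevyHopf.Minorization P D φ α ν ∧ m ≪ ν) := by
  have hMk : IsMarkovKernel P := ⟨fun x => (hA4.sol x).prob⟩
  have hinit : ∀ x, (P x).map (LevyHopf.X 0) = Measure.dirac x := fun x => (hA4.sol x).init
  have hne : Nonempty D := hDconn.nonempty.to_subtype
  have hφ0 : ∀ x, φ x ≠ 0 := hEig.pos_of_irred hIR hφ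
  have hlam : 0 < lam := hEig.lam_pos hD hET hφ (hφ0 hne.some)
  have hT := hEig.univMarkovSemigroup hD hinit hA4.strongMarkov hφ0
  refine ⟨⟨LevyHopf.unifErgResolvent_of_minorization hEig hφ hφ0 hT, fun hE α hα => ?_⟩,
    fun hE α hα => ?_⟩
  · have hα' : 0 < α + lam := by linarith
    obtain ⟨η, c, hη, hη0, hc, hle⟩ := hT.exists_le_resolvent_of_unifErgChain
      (β := α + lam + 1) (β' := α + lam) (by linarith) (by linarith) (hE _ (by linarith))
    obtain ⟨ν, hν, -⟩ := LevyHopf.exists_minorization_of_le_resolvent hEig hIR hφ0 hT hα' hη0 hc hle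
    exact ⟨ν, hν⟩
  · have hα' : 0 < α + lam := by linarith
    obtain ⟨η, c, hη, hη0, hc, hle⟩ := hT.exists_le_resolvent_of_unifErgSemigroup (α + lam) hE
    exact LevyHopf.exists_minorization_of_le_resolvent hEig hIR hφ0 hT hα' hη0 hc hle
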